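/- Let $(\mathsf S_t)_{t\ge 0}$ be the standard Gamma process on a probability space: $\mathsf S_0=0$ a.s., independent increments, $\mathsf S_t-\mathsf S_s$ has the Gamma distribution with shape $t-s$ and rate $1$ for $0\le s<t$, and almost all paths are increasing and right-continuous. For a function $f$ on $[0,\infty)$ put $$\mathsf S_tf=\int_{(0,t]}f\,d\mathsf S\ \ \text{(pathwise)},\qquad \lambda_tf=\int_0^tf(x)\,dx,\qquad R_t(f)=\frac{\mathsf S_tf}{\lambda_tf}.$$ Fix a mode of convergence: either $L^r$ with $0\le r<\infty$ (where $L^0$ means convergence in probability) or almost sure convergence. We say that $f$ satisfies orderly divergence (OD) in this mode if $R_t(f)\to1$ in this mode as $t\to\infty$. Let $f:[0,\infty)\to[0,\infty)$ be monotonic (increasing or decreasing) with $\lambda_tf\to\infty$ as $t\to\infty$. Let $p\ge0$, $q>0$ be arbitrary and put $t_n=p+qn$ for $n=0,1,2,\dots$. Then, in the fixed mode: 1. The following are equivalent: (a) $f$ satisfies OD; (b) $R_{t_n}(f)\to1$ as $n\to\infty$; (c) the weighted law of large numbers for the discretization of $f$ along $(t_n)$ holds, that is, $$\frac{\sum_{k=1}^n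 f(t_k)\,X_k}{q\sum_{k=1}^n f(t_k)}\to 1\quad(n\to\infty),\qquad X_k=\mathsf S_{t_k}-\mathsf S_{t_{k-1}},$$ where the $X_k$ are i.i.d. Gamma variables with shape and mean $q$. In particular (b) and (c) hold either for all arithmetic sequences $(t_n)$ or for none. 2. Let $g:[0,\infty)\to\mathbb R$ be a measure-preserving rearrangement of $f$ between the nodes $t_n$; that is, on $(0,t_0]$ and on each interval $(t_k,t_{k+1}]$, $k\ge0$, the functions $g$ and $f$ are Lebesgue measurable and equimeasurable (the image of Lebesgue measure on the interval is the same under both). Then $g$ satisfies OD if and only if $f$ does. -/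

import Mathlib

open MeasureTheory ProbabilityTheory Filter Topology Set
open scoped NNReal ENNReal

noncomputable section

/-- `S` is a standard Gamma process on `[0, ∞)`, that is, the Lévy subordinator for which
`S 1` is exponential with mean `1`: it starts at `0`, has independent increments, `S t - S s` has
the Gamma distribution with shape `t - s` and rate `1` for `s < t`, and almost all paths are
increasing and right-continuous. -/
structure IsGammaProcess {Ω : Type*} [MeasurableSpace Ω] (S : ℝ≥0 → Ω → ℝ) (P : Measure Ω) :
    Prop where
  start_zero : ∀ᵐ ω ∂P, S 0 ω = 0
  indep_increments : HasIndepIncrements S P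
  law_increment : ∀ s t : ℝ≥0, s < t →
    HasLaw (fun ω => S t ω - S s ω) (gammaMeasure ((t : ℝ) - (s : ℝ)) 1) P
  monotone_path : ∀ᵐ ω ∂P, Monotone fun t => S t ω
  right_continuous_path : ∀ᵐ ω ∂P, ∀ t, ContinuousWithinAt (fun u => S u ω) (Ici t) t

open scoped Classical in
/-- The Lebesgue–Stieltjes measure `dX` on `[0, ∞)` of a path `X`, with `dX (s, t] = X t - X s`
(and the value `0` for paths that fail to be increasing and right-continuous; such paths form a
null set for a Gamma process). -/
def pathMeasure (X : ℝ≥0 → ℝ) : Measure ℝ≥0 :=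
  if h : Monotone X ∧ ∀ t, ContinuousWithinAt X (Ici t) t then
    (StieltjesFunction.mk X h.1 h.2).measure
  else 0

/-- Lebesgue measure on `[0, ∞)`. -/
def lebesgue : Measure ℝ≥0 := Measure.comap ((↑) : ℝ≥0 → ℝ) volume

variable {Ω : Type*}

/-- The pathwise Gamma integral `S_t f = ∫_0^t f dS`. -/
def gammaIntegral (S : ℝ≥0 → Ω → ℝ) (f : ℝ≥0 → ℝ) (t : ℝ≥0) (ω : Ω) : ℝ :=
  ∫ x in Ioc 0 t, f x ∂(pathMeasure fun u => S u ω)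

/-- `λ_t f = ∫_0^t f(x) dx`. -/
def cumul (f : ℝ≥0 → ℝ) (t : ℝ≥0) : ℝ :=
  ∫ x in Ioc 0 t, f x ∂lebesgue

/-- `R_t = S_t f / λ_t f`. -/
def gammaRatio (S : ℝ≥0 → Ω → ℝ) (f : ℝ≥0 → ℝ) (t : ℝ≥0) (ω : Ω) : ℝ :=
  gammaIntegral S f t ω / cumul f t

/-- The modes of convergence: `L^0` (in probability), `L^r` for `0 < r < ∞`, almost sure. -/
inductive ConvMode where
  | inProbability : ConvMode
  | inLp (r : ℝ≥0) (hr : 0 < r) : ConvMode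
  | almostSure : ConvMode

/-- The random variables `R i` converge to the constant `1` along the filter `l`, in the given
mode. -/
def ConvMode.TendstoOne [MeasurableSpace Ω] (m : ConvMode) (P : Measure Ω) {ι : Type*}
    (R : ι → Ω → ℝ) (l : Filter ι) : Prop :=
  match m with
  | .inProbability => TendstoInMeasure P R l fun _ => 1
  | .inLp r _ => Tendsto (fun i => eLpNorm (fun ω => R i ω - 1) (r : ℝ≥0∞) P) l (𝓝 0)
  | .almostSure => ∀ᵐ ω ∂P, Tendsto (fun i => R i ω) l (𝓝 1)

/-- Orderly divergence of `f` in the mode `m`: `R_t → 1` as `t → ∞`. -/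
def OrderlyDivergence [MeasurableSpace Ω] (m : ConvMode) (P : Measure Ω) (S : ℝ≥0 → Ω → ℝ)
    (f : ℝ≥0 → ℝ) : Prop :=
  m.TendstoOne P (gammaRatio S f) atTop

/-- The arithmetic sequence of nodes `t_n = p + q n`. -/
def node (p q : ℝ≥0) (n : ℕ) : ℝ≥0 := p + q * n

/-- Orderly divergence of `f` along the nodes: `R_{t_n} → 1` as `n → ∞`. -/
def OrderlyDivergenceAlong [MeasurableSpace Ω] (m : ConvMode) (P : Measure Ω)
    (S : ℝ≥0 → Ω → ℝ) (f : ℝ≥0 → ℝ) (p q : ℝ≥0) : Prop :=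
  m.TendstoOne P (fun n : ℕ => gammaRatio S f (node p q n)) atTop

/-- The normalized weighted sum `∑_{k=1}^n w_k X_k / ∑_{k=1}^n w_k E X_k` with weights
`w_k = f (t_k)` and the i.i.d. variables `X_k = S_{t_k} - S_{t_{k-1}}`, whose law is the Gamma
distribution with shape (and mean) `q`. -/
def discreteRatio (S : ℝ≥0 → Ω → ℝ) (f : ℝ≥0 → ℝ) (p q : ℝ≥0) (n : ℕ) (ω : Ω) : ℝ :=
  (∑ k ∈ Finset.Icc 1 n, f (node p q k) * (S (node p q k) ω - S (node p q (k - 1)) ω)) /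
    ∑ k ∈ Finset.Icc 1 n, f (node p q k) * (q : ℝ)

/-- The weighted law of large numbers, in the mode `m`, for the discretization of `f` along the
nodes `t_n = p + q n`. -/
def DiscreteOrderlyDivergence [MeasurableSpace Ω] (m : ConvMode) (P : Measure Ω)
    (S : ℝ≥0 → Ω → ℝ) (f : ℝ≥0 → ℝ) (p q : ℝ≥0) : Prop :=
  m.TendstoOne P (discreteRatio S f p q) atTop

/-- `g` is a measure-preserving rearrangement of `f` between the nodes `t_n = p + q n`: on the
initial interval `(0, t_0]` and on each interval `(t_k, t_{k+1}]`, the functions `g` and `f` are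
equimeasurable with respect to Lebesgue measure. -/
def IsRearrangementBetweenNodes (g f : ℝ≥0 → ℝ) (p q : ℝ≥0) : Prop :=
  IdentDistrib g f (lebesgue.restrict (Ioc 0 (node p q 0)))
    (lebesgue.restrict (Ioc 0 (node p q 0))) ∧
  ∀ k : ℕ, IdentDistrib g f (lebesgue.restrict (Ioc (node p q k) (node p q (k + 1))))
    (lebesgue.restrict (Ioc (node p q k) (node p q (k + 1))))

end

/-!
For `f` with values in the right half-plane, the Laplace functional of the Gamma process is
`E exp (-∫ f dS) = exp (-∫ log (1 + f) dx)`. It depends on `f` only through the distribution of `f`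
under Lebesgue measure; applied to real multiples of `i f` on successive blocks, it shows that the
joint law of the integrals of `f` over the blocks is unchanged when `f` is rearranged within each
block. This already settles rearrangements as far as convergence along the nodes is concerned.

To pass from the nodes to all times, write `L_n = λ_{t_n} f`. Convergence along the nodes in any
mode implies convergence in probability, hence
`-log E exp (-R_{t_n}) = ∫_{(0, t_n]} log (1 + f / L_n) dx` tends to `1 = ∫_{(0, t_n]} f / L_n dx`.
So the defect `∫ (f / L_n - log (1 + f / L_n)) dx` vanishes in the limit. As the blocks have
bounded length, this forces `L_n - L_{n-1} = o(L_n)`. Both `S_t f` and `λ_t f` are increasing in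
`t`, and are therefore squeezed between their values at neighbouring nodes.

For the discretization of a monotone `f`, the left and right Riemann sums of `∫ f dS` have the same
joint law, because the increments of `S` are i.i.d.; they enclose the integral up to a shift by one
node and an error that does not grow. Both perturbations are negligible by the previous argument,
which applies to `f` and to its discretization alike.
-/

section GammaDistribution

variable {a r : ℝ}

lemma lintegral_rpow_mul_exp_gammaMeasure (ha : 0 < a) (hr : 0 < r) {s t : ℝ} (hs : 0 < a + s)
    (ht : t < r) :
    ∫⁻ x, ENNReal.ofReal x ^ s * ENNReal.ofReal (Real.exp (t * x)) ∂gammaMeasure a r =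
      ENNReal.ofReal (Real.Gamma (a + s) / Real.Gamma a * (r ^ a / (r - t) ^ (a + s))) := by
  have _ := Real.Gamma_pos_of_pos ha
  have _ := Real.Gamma_pos_of_pos hs
  have htilt : 0 < r - t := sub_pos.2 ht
  have hmeas (b c : ℝ) : Measurable (gammaPDF b c) := (measurable_gammaPDFReal b c).ennreal_ofReal
  have hdensity : ∀ᵐ x : ℝ,
      gammaPDF a r x * (ENNReal.ofReal x ^ s * ENNReal.ofReal (Real.exp (t * x))) =
        ENNReal.ofReal (Real.Gamma (a + s) / Real.Gamma a * (r ^ a / (r - t) ^ (a + s))) *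
          gammaPDF (a + s) (r - t) x := by
    filter_upwards [Measure.ae_ne volume 0] with x hx
    rcases hx.lt_or_gt with hx | hx
    · simp [gammaPDF_of_neg hx]
    · rw [gammaPDF_of_nonneg hx.le, gammaPDF_of_nonneg hx.le, ENNReal.ofReal_rpow_of_pos hx,
        ← ENNReal.ofReal_mul (by positivity), ← ENNReal.ofReal_mul (by positivity),
        ← ENNReal.ofReal_mul (by positivity), add_sub_right_comm, Real.rpow_add hx,
        show -((r - t) * x) = -(r * x) + t * x by ring, Real.exp_add]
      congr 1
      field_simp
  rw [gammaMeasure, lintegral_withDensity_eq_lintegral_mul₀ (hmeas a r).aemeasurable (by fun_prop)]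
  simp only [Pi.mul_apply]
  rw [lintegral_congr_ae hdensity, lintegral_const_mul _ (hmeas _ _),
    lintegral_gammaPDF_eq_one hs htilt, mul_one]

lemma lintegral_ofReal_gammaMeasure (ha : 0 < a) (hr : 0 < r) :
    ∫⁻ x, ENNReal.ofReal x ∂gammaMeasure a r = ENNReal.ofReal (a / r) := by
  have h := lintegral_rpow_mul_exp_gammaMeasure ha hr (s := 1) (t := 0) (by positivity) hr
  simp only [ENNReal.rpow_one, zero_mul, Real.exp_zero, ENNReal.ofReal_one, mul_one, sub_zero] at h
  rw [h, Real.Gamma_add_one ha.ne', Real.rpow_add_one hr.ne']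
  have := Real.Gamma_pos_of_pos ha
  congr 1
  field_simp

lemma lintegral_exp_mul_gammaMeasure (ha : 0 < a) (hr : 0 < r) {t : ℝ} (ht : t < r) :
    ∫⁻ x, ENNReal.ofReal (Real.exp (t * x)) ∂gammaMeasure a r =
      ENNReal.ofReal ((1 - t / r) ^ (-a)) := by
  have h := lintegral_rpow_mul_exp_gammaMeasure ha hr (s := 0) (by simpa) ht
  have htr : 0 < r - t := sub_pos.2 ht
  simp only [ENNReal.rpow_zero, one_mul, add_zero,
    div_self (Real.Gamma_pos_of_pos ha).ne'] at h
  rw [h, one_sub_div hr.ne', Real.rpow_neg (by positivity), ← Real.inv_rpow (by positivity),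
    inv_div, Real.div_rpow hr.le htr.le]

lemma Iio_subset_interior_integrableExpSet_gammaMeasure (ha : 0 < a) (hr : 0 < r) :
    Iio r ⊆ interior (integrableExpSet id (gammaMeasure a r)) := by
  refine interior_maximal (fun t ht => ⟨by fun_prop, ?_⟩) isOpen_Iio
  rw [hasFiniteIntegral_iff_ofReal (ae_of_all _ fun x => (Real.exp_pos _).le)]
  exact (lintegral_exp_mul_gammaMeasure ha hr ht).trans_lt ENNReal.ofReal_lt_top

lemma memLp_id_gammaMeasure (ha : 0 < a) (hr : 0 < r) (s : ℝ≥0) :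
    MemLp id s (gammaMeasure a r) :=
  memLp_of_mem_interior_integrableExpSet
    (Iio_subset_interior_integrableExpSet_gammaMeasure ha hr hr) s

lemma mgf_id_gammaMeasure (ha : 0 < a) (hr : 0 < r) {t : ℝ} (ht : t < r) :
    mgf id (gammaMeasure a r) t = (1 - t / r) ^ (-a) := by
  have htr : 0 < 1 - t / r := sub_pos.2 ((div_lt_one hr).2 ht)
  rw [mgf, integral_eq_lintegral_of_nonneg_ae (ae_of_all _ fun x => (Real.exp_pos _).le)
    (by fun_prop)]
  exact (congrArg _ (lintegral_exp_mul_gammaMeasure ha hr ht)).trans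
    (ENNReal.toReal_ofReal (by positivity))

lemma complexMGF_id_gammaMeasure (ha : 0 < a) (hr : 0 < r) {z : ℂ} (hz : z.re < r) :
    complexMGF id (gammaMeasure a r) z = (1 - z / r) ^ (-a : ℂ) := by
  let U : Set ℂ := {z | z.re < r}
  have hU : IsOpen U := isOpen_lt Complex.continuous_re continuous_const
  have hU' : IsPreconnected U := (convex_halfSpace_re_lt r).isPreconnected
  have hslit (z : ℂ) (hz : z ∈ U) : 1 - z / r ∈ Complex.slitPlane := by
    left
    simpa [Complex.div_ofReal_re] using (div_lt_one hr).2 hz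
  have hanalytic : AnalyticOnNhd ℂ (complexMGF id (gammaMeasure a r)) U :=
    analyticOnNhd_complexMGF.mono fun z hz =>
      Iio_subset_interior_integrableExpSet_gammaMeasure ha hr hz
  have hanalytic' : AnalyticOnNhd ℂ (fun z : ℂ => (1 - z / r) ^ (-a : ℂ)) U :=
    DifferentiableOn.analyticOnNhd (fun z hz => DifferentiableAt.differentiableWithinAt <|
      DifferentiableAt.cpow (by fun_prop) (by fun_prop) (hslit z hz)) hU
  refine hanalytic.eqOn_of_preconnected_of_frequently_eq hanalytic' hU' (z₀ := 0)
    (by simpa [U] using hr) ?_ hz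
  have hreal : ∀ᶠ t : ℝ in 𝓝[≠] 0,
      complexMGF id (gammaMeasure a r) t = (1 - (t : ℂ) / r) ^ (-a : ℂ) := by
    filter_upwards [eventually_nhdsWithin_of_eventually_nhds (gt_mem_nhds hr)] with t ht
    have htr : 0 ≤ 1 - t / r := (sub_pos.2 ((div_lt_one hr).2 ht)).le
    rw [complexMGF_ofReal, mgf_id_gammaMeasure ha hr ht, Complex.ofReal_cpow htr]
    push_cast
    rfl
  have hcoe : Tendsto (fun t : ℝ => (t : ℂ)) (𝓝[≠] 0) (𝓝[≠] 0) := by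
    simpa using Complex.continuous_ofReal.continuousWithinAt.tendsto_nhdsWithin
      (x := 0) (s := {0}ᶜ) (t := {0}ᶜ) fun t ht => by simpa using ht
  exact hcoe.frequently hreal.frequently

end GammaDistribution

section HalfLineMeasures

lemma measurableEmbedding_nnreal_coe : MeasurableEmbedding ((↑) : ℝ≥0 → ℝ) :=
  .subtype_coe measurableSet_Ici

lemma lebesgue_Ioc (a b : ℝ≥0) : lebesgue (Ioc a b) = ENNReal.ofReal ((b : ℝ) - a) := by
  have himage : ((↑) : ℝ≥0 → ℝ) '' Ioc a b = Ioc (a : ℝ) b :=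
    image_subtype_val_Ioc (s := Ici (0 : ℝ)) a b
  rw [lebesgue, measurableEmbedding_nnreal_coe.comap_apply, himage, Real.volume_Ioc]

lemma lebesgue_real_Ioc {a b : ℝ≥0} (hab : a ≤ b) : lebesgue.real (Ioc a b) = b - a := by
  rw [Measure.real, lebesgue_Ioc, ENNReal.toReal_ofReal (sub_nonneg.2 (NNReal.coe_le_coe.2 hab))]

instance : IsLocallyFiniteMeasure lebesgue :=
  have : IsFiniteMeasureOnCompacts lebesgue :=
    .comap' _ NNReal.continuous_coe measurableEmbedding_nnreal_coe
  inferInstance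

lemma pathMeasure_Ioc {X : ℝ≥0 → ℝ} (hmono : Monotone X)
    (hcont : ∀ t, ContinuousWithinAt X (Ici t) t) (a b : ℝ≥0) :
    pathMeasure X (Ioc a b) = ENNReal.ofReal (X b - X a) := by
  rw [pathMeasure, dif_pos ⟨hmono, hcont⟩, StieltjesFunction.measure_Ioc]

instance (X : ℝ≥0 → ℝ) : IsLocallyFiniteMeasure (pathMeasure X) := by
  unfold pathMeasure
  split_ifs <;> infer_instance

end HalfLineMeasures

section RegularVersion

lemma measurable_of_dense_of_rightContinuous {Ω T E : Type*} [MeasurableSpace Ω]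
    [TopologicalSpace T] [LinearOrder T] [OrderTopology T] [DenselyOrdered T] [NoMaxOrder T]
    [FirstCountableTopology T] [TopologicalSpace E] [TopologicalSpace.PseudoMetrizableSpace E]
    [MeasurableSpace E] [BorelSpace E] {X : T → Ω → E} {D : Set T} (hD : Dense D)
    (hX : ∀ d ∈ D, Measurable (X d))
    (hcont : ∀ ω t, ContinuousWithinAt (fun u => X u ω) (Ici t) t) (t : T) :
    Measurable (X t) := by
  have hclosure : t ∈ closure (Ioi t ∩ D) := by
    refine closure_minimal (hD.open_subset_closure_inter isOpen_Ioi) isClosed_closure ?_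
    exact closure_Ioi t ▸ self_mem_Ici
  obtain ⟨u, hu, hlim⟩ := mem_closure_iff_seq_limit.1 hclosure
  refine measurable_of_tendsto_metrizable (fun n => hX (u n) (hu n).2)
    (tendsto_pi_nhds.2 fun ω => ?_)
  exact (hcont ω t).tendsto.comp
    (tendsto_nhdsWithin_iff.2 ⟨hlim, Eventually.of_forall fun n => (hu n).1.le⟩)

/-- A standard Gamma process that is measurable at each time and whose paths are all, rather than
almost all, increasing and right-continuous, so that each path has a genuine Stieltjes measure. -/
structure IsRegularGammaProcess {Ω : Type*} [MeasurableSpace Ω] (S : ℝ≥0 → Ω → ℝ)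
    (P : Measure Ω) : Prop extends IsGammaProcess S P where
  measurable : ∀ t, Measurable (S t)
  monotone : ∀ ω, Monotone fun t => S t ω
  rightContinuous : ∀ ω t, ContinuousWithinAt (fun u => S u ω) (Ici t) t

namespace IsGammaProcess

variable {Ω : Type*} [MeasurableSpace Ω] {P : Measure Ω} {S S' : ℝ≥0 → Ω → ℝ}

lemma aemeasurable (hS : IsGammaProcess S P) (t : ℝ≥0) : AEMeasurable (S t) P := by
  rcases eq_zero_or_pos t with rfl | ht
  · exact aemeasurable_const.congr (EventuallyEq.symm hS.start_zero)
  · refine (hS.law_increment 0 t ht).aemeasurable.congr ?_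
    filter_upwards [hS.start_zero] with ω hω
    simp [hω]

lemma congr (hS : IsGammaProcess S P) (h : ∀ᵐ ω ∂P, ∀ t, S' t ω = S t ω) :
    IsGammaProcess S' P where
  start_zero := by filter_upwards [h, hS.start_zero] with ω hω h0 using (hω 0).trans h0
  indep_increments n t ht := (hS.indep_increments n t ht).congr fun i => by
    filter_upwards [h] with ω hω
    rw [hω, hω]
  law_increment s t hst := (hS.law_increment s t hst).congr (by
    filter_upwards [h] with ω hω
    rw [hω, hω])
  monotone_path := by filter_upwards [h, hS.monotone_path] with ω hω hmono using by simpa [hω]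
  right_continuous_path := by
    filter_upwards [h, hS.right_continuous_path] with ω hω hcont using by simpa [hω]

theorem exists_isRegularGammaProcess (hS : IsGammaProcess S P) :
    ∃ S' : ℝ≥0 → Ω → ℝ, IsRegularGammaProcess S' P ∧ ∀ᵐ ω ∂P, ∀ t, S' t ω = S t ω := by
  obtain ⟨D, hDcount, hDdense⟩ := TopologicalSpace.exists_countable_dense ℝ≥0
  have hgood : ∀ᵐ ω ∂P, (∀ d ∈ D, S d ω = (hS.aemeasurable d).mk _ ω) ∧
      (Monotone fun t => S t ω) ∧ ∀ t, ContinuousWithinAt (fun u => S u ω) (Ici t) t :=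
    ((ae_ball_iff hDcount).2 fun d _ => (hS.aemeasurable d).ae_eq_mk).and
      (hS.monotone_path.and hS.right_continuous_path)
  obtain ⟨G, hG, hGmeas, hgoodG⟩ := hgood.exists_measurable_mem
  have hversion : ∀ᵐ ω ∂P, ∀ t, G.indicator (S t) ω = S t ω := by
    filter_upwards [hG] with ω hω t using indicator_of_mem hω _
  have hcont (ω : Ω) (t : ℝ≥0) : ContinuousWithinAt (fun u => G.indicator (S u) ω) (Ici t) t := by
    by_cases hω : ω ∈ G
    · simpa only [indicator_of_mem hω] using (hgoodG ω hω).2.2 t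
    · simpa only [indicator_of_notMem hω] using continuousWithinAt_const
  refine ⟨fun t => G.indicator (S t), ⟨hS.congr hversion, ?_, fun ω => ?_, hcont⟩, hversion⟩
  · refine measurable_of_dense_of_rightContinuous hDdense (fun d hd => ?_) hcont
    rw [indicator_congr fun ω hω => (hgoodG ω hω).1 d hd]
    exact (hS.aemeasurable d).measurable_mk.indicator hGmeas
  · by_cases hω : ω ∈ G
    · simpa only [indicator_of_mem hω] using (hgoodG ω hω).2.1
    · simpa only [indicator_of_notMem hω] using monotone_const

end IsGammaProcess

end RegularVersion

section IntensityMeasure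

namespace IsRegularGammaProcess

variable {Ω : Type*} [MeasurableSpace Ω] {P : Measure Ω} {S : ℝ≥0 → Ω → ℝ}
  (hS : IsRegularGammaProcess S P)
include hS

lemma pathMeasure_Ioc (ω : Ω) (a b : ℝ≥0) :
    pathMeasure (fun u => S u ω) (Ioc a b) = ENNReal.ofReal (S b ω - S a ω) :=
  _root_.pathMeasure_Ioc (hS.monotone ω) (hS.rightContinuous ω) a b

lemma pathMeasure_real_Ioc (ω : Ω) {a b : ℝ≥0} (hab : a ≤ b) :
    (pathMeasure fun u => S u ω).real (Ioc a b) = S b ω - S a ω := by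
  rw [Measure.real, hS.pathMeasure_Ioc, ENNReal.toReal_ofReal (sub_nonneg.2 (hS.monotone ω hab))]

lemma measurable_restrict_pathMeasure (a b : ℝ≥0) :
    Measurable fun ω => (pathMeasure fun u => S u ω).restrict (Ioc a b) := by
  have hincrement (c : ℝ≥0) : Measurable fun ω => pathMeasure (fun u => S u ω) (Ioc a c) := by
    simp only [hS.pathMeasure_Ioc]
    exact ((hS.measurable c).sub (hS.measurable a)).ennreal_ofReal
  have hfinite (ω : Ω) : IsFiniteMeasure ((pathMeasure fun u => S u ω).restrict (Ioc a b)) :=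
    isFiniteMeasure_restrict.2 measure_Ioc_lt_top.ne
  refine Measurable.measure_of_isPiSystem
    (BorelSpace.measurable_eq.trans (borel_eq_generateFrom_Iic ℝ≥0)) isPiSystem_Iic ?_ ?_
  · rintro _ ⟨c, rfl⟩
    simp only [Measure.restrict_apply measurableSet_Iic, inter_comm (Iic c), Ioc_inter_Iic]
    exact hincrement _
  · simpa only [Measure.restrict_apply_univ] using hincrement b

lemma lintegral_increment (a b : ℝ≥0) :
    ∫⁻ ω, ENNReal.ofReal (S b ω - S a ω) ∂P = ENNReal.ofReal ((b : ℝ) - a) := by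
  rcases le_or_gt b a with hba | hab
  · simp [ENNReal.ofReal_of_nonpos, hS.monotone _ hba, hba]
  · have hlaw := hS.law_increment a b hab
    rw [hlaw.lintegral_comp (f := ENNReal.ofReal) (by fun_prop),
      lintegral_ofReal_gammaMeasure (sub_pos.2 (NNReal.coe_lt_coe.2 hab)) one_pos, div_one]

theorem bind_restrict_pathMeasure (a b : ℝ≥0) :
    P.bind (fun ω => (pathMeasure fun u => S u ω).restrict (Ioc a b)) =
      lebesgue.restrict (Ioc a b) := by
  have : IsFiniteMeasure (lebesgue.restrict (Ioc a b)) :=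
    isFiniteMeasure_restrict.2 measure_Ioc_lt_top.ne
  refine (Measure.ext_of_Iic _ _ fun c => ?_).symm
  have hmeas := (hS.measurable_restrict_pathMeasure a b).aemeasurable (μ := P)
  simp only [Measure.bind_apply measurableSet_Iic hmeas, Measure.restrict_apply measurableSet_Iic,
    inter_comm (Iic c), Ioc_inter_Iic, lebesgue_Ioc, hS.pathMeasure_Ioc]
  exact (hS.lintegral_increment _ _).symm

lemma lintegral_lintegral_pathMeasure (a b : ℝ≥0) {h : ℝ≥0 → ℝ≥0∞} (hh : Measurable h) :
    ∫⁻ ω, ∫⁻ x in Ioc a b, h x ∂(pathMeasure fun u => S u ω) ∂P =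
      ∫⁻ x in Ioc a b, h x ∂lebesgue := by
  rw [← hS.bind_restrict_pathMeasure a b,
    Measure.lintegral_bind (hS.measurable_restrict_pathMeasure a b).aemeasurable hh.aemeasurable]

lemma measurable_lintegral_pathMeasure (a b : ℝ≥0) {h : ℝ≥0 → ℝ≥0∞} (hh : Measurable h) :
    Measurable fun ω => ∫⁻ x in Ioc a b, h x ∂(pathMeasure fun u => S u ω) :=
  (Measure.measurable_lintegral hh).comp (hS.measurable_restrict_pathMeasure a b)

lemma ae_ae_restrict_pathMeasure {a b : ℝ≥0} {p : ℝ≥0 → Prop}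
    (h : ∀ᵐ x ∂lebesgue.restrict (Ioc a b), p x) :
    ∀ᵐ ω ∂P, ∀ᵐ x ∂(pathMeasure fun u => S u ω).restrict (Ioc a b), p x := by
  rw [← hS.bind_restrict_pathMeasure a b] at h
  exact Measure.ae_ae_of_ae_bind (hS.measurable_restrict_pathMeasure a b).aemeasurable h

section Integral

variable {E : Type*} [NormedAddCommGroup E] {h : ℝ≥0 → E}

lemma ae_integrableOn_pathMeasure {a b : ℝ≥0} (hh : StronglyMeasurable h)
    (hint : IntegrableOn h (Ioc a b) lebesgue) :
    ∀ᵐ ω ∂P, IntegrableOn h (Ioc a b) (pathMeasure fun u => S u ω) := by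
  have hfinite : ∫⁻ ω, ∫⁻ x in Ioc a b, ‖h x‖ₑ ∂(pathMeasure fun u => S u ω) ∂P ≠ ∞ := by
    rw [hS.lintegral_lintegral_pathMeasure a b hh.enorm]
    exact hint.2.ne
  filter_upwards [ae_lt_top (hS.measurable_lintegral_pathMeasure a b hh.enorm) hfinite] with ω hω
  exact ⟨hh.aestronglyMeasurable, hω⟩

lemma ae_forall_integrableOn_pathMeasure (hh : StronglyMeasurable h)
    (hint : ∀ T, IntegrableOn h (Ioc 0 T) lebesgue) :
    ∀ᵐ ω ∂P, ∀ T, IntegrableOn h (Ioc 0 T) (pathMeasure fun u => S u ω) := by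
  filter_upwards [ae_all_iff.2 fun n : ℕ => hS.ae_integrableOn_pathMeasure hh (hint n)] with ω hω T
  obtain ⟨n, hn⟩ := exists_nat_ge T
  exact (hω n).mono_set (Ioc_subset_Ioc_right hn)

variable [NormedSpace ℝ E]

lemma stronglyMeasurable_integral_pathMeasure (a b : ℝ≥0) (hh : StronglyMeasurable h) :
    StronglyMeasurable fun ω => ∫ x in Ioc a b, h x ∂(pathMeasure fun u => S u ω) :=
  StronglyMeasurable.integral_kernel
    (κ := ⟨fun ω => (pathMeasure fun u => S u ω).restrict (Ioc a b),
      hS.measurable_restrict_pathMeasure a b⟩) hh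

end Integral

end IsRegularGammaProcess

end IntensityMeasure

section StepFunctions

lemma setIntegral_Ioc_add_setIntegral_Ioc {α E : Type*} [LinearOrder α] [TopologicalSpace α]
    [OrderClosedTopology α] [MeasurableSpace α] [OpensMeasurableSpace α] [NormedAddCommGroup E]
    [NormedSpace ℝ E] {μ : Measure α} {h : α → E} {a b c : α} (hab : a ≤ b) (hbc : b ≤ c)
    (hint : IntegrableOn h (Ioc a c) μ) :
    ∫ x in Ioc a b, h x ∂μ + ∫ x in Ioc b c, h x ∂μ = ∫ x in Ioc a c, h x ∂μ := by
  rw [← Ioc_union_Ioc_eq_Ioc hab hbc] at hint ⊢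
  exact (setIntegral_union (Ioc_disjoint_Ioc_of_le le_rfl) measurableSet_Ioc hint.left_of_union
    hint.right_of_union).symm

variable {α E : Type*} [LinearOrder α] [NormedAddCommGroup E]

/-- The function with value `c j` on each block `(τ j, τ (j + 1)]` and `0` off the blocks. The
blocks are pairwise disjoint for monotone `τ`, so the sum has at most one non-zero term. -/
noncomputable def stepFunction (τ : ℕ → α) (c : ℕ → E) (x : α) : E :=
  ∑' j, (Ioc (τ j) (τ (j + 1))).indicator (fun _ => c j) x

variable {τ : ℕ → α} (hτ : Monotone τ) {c : ℕ → E}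
include hτ

lemma eq_of_mem_Ioc_of_mem_Ioc {i j : ℕ} {x : α} (hi : x ∈ Ioc (τ i) (τ (i + 1)))
    (hj : x ∈ Ioc (τ j) (τ (j + 1))) : i = j :=
  by_contra fun hij => disjoint_left.1 (hτ.pairwise_disjoint_on_Ioc_succ hij) hi hj

lemma stepFunction_of_mem_Ioc {j : ℕ} {x : α} (hx : x ∈ Ioc (τ j) (τ (j + 1))) :
    stepFunction τ c x = c j := by
  rw [stepFunction, tsum_eq_single j, indicator_of_mem hx]
  exact fun i hij => indicator_of_notMem (fun hi => hij (eq_of_mem_Ioc_of_mem_Ioc hτ hi hx)) _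

lemma exists_mem_Ioc_of_tendsto_atTop [NoMaxOrder α] (hlim : Tendsto τ atTop atTop) {x : α}
    (hx : τ 0 < x) : ∃ j, x ∈ Ioc (τ j) (τ (j + 1)) := by
  have hunion := iUnion_Ioc_map_succ_eq_Ioi (fun j => hτ bot_le)
    (not_bddAbove_of_tendsto_atTop hlim)
  exact mem_iUnion.1 (hunion.ge hx)

omit hτ in
lemma stepFunction_of_forall_notMem_Ioc {x : α} (hx : ∀ j, x ∉ Ioc (τ j) (τ (j + 1))) :
    stepFunction τ c x = 0 := by
  simp [stepFunction, indicator_of_notMem (hx _)]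

lemma apply_stepFunction {F : Type*} [NormedAddCommGroup F] {g : E → F} (h0 : g 0 = 0) (x : α) :
    g (stepFunction τ c x) = stepFunction τ (g ∘ c) x := by
  by_cases hx : ∃ j, x ∈ Ioc (τ j) (τ (j + 1))
  · obtain ⟨j, hj⟩ := hx
    rw [stepFunction_of_mem_Ioc hτ hj, stepFunction_of_mem_Ioc hτ hj, Function.comp_apply]
  · have hx := not_exists.1 hx
    rw [stepFunction_of_forall_notMem_Ioc hx, stepFunction_of_forall_notMem_Ioc hx, h0]

lemma stepFunction_mem {s : Set E} (h0 : 0 ∈ s) (hc : ∀ j, c j ∈ s) (x : α) :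
    stepFunction τ c x ∈ s := by
  by_cases hx : ∃ j, x ∈ Ioc (τ j) (τ (j + 1))
  · obtain ⟨j, hj⟩ := hx
    rw [stepFunction_of_mem_Ioc hτ hj]
    exact hc j
  · rwa [stepFunction_of_forall_notMem_Ioc (not_exists.1 hx)]

variable [MeasurableSpace α] [TopologicalSpace α] [OrderClosedTopology α] [OpensMeasurableSpace α]

lemma stronglyMeasurable_stepFunction : StronglyMeasurable (stepFunction τ c) := by
  refine stronglyMeasurable_of_tendsto atTop (fun n => Finset.stronglyMeasurable_fun_sum
    (Finset.range n) fun j _ => stronglyMeasurable_const.indicator measurableSet_Ioc)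
    (tendsto_pi_nhds.2 fun x => (summable_of_hasFiniteSupport ?_).hasSum.tendsto_sum_nat)
  refine Set.Subsingleton.finite fun i hi j hj => eq_of_mem_Ioc_of_mem_Ioc hτ (x := x) ?_ ?_
  · exact mem_of_indicator_ne_zero hi
  · exact mem_of_indicator_ne_zero hj

variable {μ : Measure α}

lemma setIntegral_Ioc_eq_sum [NormedSpace ℝ E] {h : α → E} (n : ℕ)
    (hint : IntegrableOn h (Ioc (τ 0) (τ n)) μ) :
    ∫ x in Ioc (τ 0) (τ n), h x ∂μ =
      ∑ j ∈ Finset.range n, ∫ x in Ioc (τ j) (τ (j + 1)), h x ∂μ := by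
  induction n with
  | zero => simp
  | succ n ih =>
    have hsub : Ioc (τ 0) (τ n) ⊆ Ioc (τ 0) (τ (n + 1)) := Ioc_subset_Ioc_right (hτ n.le_succ)
    rw [Finset.sum_range_succ, ← ih (hint.mono_set hsub),
      setIntegral_Ioc_add_setIntegral_Ioc (hτ n.zero_le) (hτ n.le_succ) hint]

omit [TopologicalSpace α] [OrderClosedTopology α] [OpensMeasurableSpace α] in
lemma integrableOn_Ioc_of_forall_integrableOn {h : α → E} {n : ℕ}
    (hint : ∀ j < n, IntegrableOn h (Ioc (τ j) (τ (j + 1))) μ) :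
    IntegrableOn h (Ioc (τ 0) (τ n)) μ := by
  induction n with
  | zero => simp
  | succ n ih =>
    rw [← Ioc_union_Ioc_eq_Ioc (hτ n.zero_le) (hτ n.le_succ)]
    exact (ih fun j hj => hint j (hj.trans n.lt_succ_self)).union (hint n n.lt_succ_self)

lemma integrableOn_stepFunction_smul [NormedSpace ℝ E] {c : ℕ → ℝ} {h : α → E} {n : ℕ}
    (hint : IntegrableOn h (Ioc (τ 0) (τ n)) μ) :
    IntegrableOn (fun x => stepFunction τ c x • h x) (Ioc (τ 0) (τ n)) μ := by
  refine integrableOn_Ioc_of_forall_integrableOn hτ fun j hj => ?_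
  have hblock : Ioc (τ j) (τ (j + 1)) ⊆ Ioc (τ 0) (τ n) :=
    Ioc_subset_Ioc (hτ j.zero_le) (hτ hj)
  have hconst : IntegrableOn (fun x => c j • h x) (Ioc (τ j) (τ (j + 1))) μ :=
    (hint.mono_set hblock).smul (c j)
  exact hconst.congr_fun (fun x hx => by rw [stepFunction_of_mem_Ioc hτ hx]) measurableSet_Ioc

variable [CompactIccSpace α] [IsLocallyFiniteMeasure μ]

lemma integrableOn_stepFunction (n : ℕ) : IntegrableOn (stepFunction τ c) (Ioc (τ 0) (τ n)) μ :=
  integrableOn_Ioc_of_forall_integrableOn hτ fun j _ =>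
    (integrableOn_const (C := c j) measure_Ioc_lt_top.ne (by simp)).congr_fun
      (fun _ hx => (stepFunction_of_mem_Ioc hτ hx).symm) measurableSet_Ioc

lemma setIntegral_stepFunction [NormedSpace ℝ E] [CompleteSpace E] (n : ℕ) :
    ∫ x in Ioc (τ 0) (τ n), stepFunction τ c x ∂μ =
      ∑ j ∈ Finset.range n, μ.real (Ioc (τ j) (τ (j + 1))) • c j := by
  rw [setIntegral_Ioc_eq_sum hτ n (integrableOn_stepFunction hτ n)]
  refine Finset.sum_congr rfl fun j _ => ?_
  rw [setIntegral_congr_fun measurableSet_Ioc fun x hx => stepFunction_of_mem_Ioc hτ hx,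
    setIntegral_const]

end StepFunctions

section Nodes

variable (p q : ℝ≥0)

lemma node_zero : node p q 0 = p := by simp [node]

lemma node_monotone : Monotone (node p q) := fun _ _ hmn => by
  unfold node
  gcongr

lemma node_succ (n : ℕ) : node p q (n + 1) = node p q n + q := by
  rw [node, node, Nat.cast_succ, mul_add_one, add_assoc]

lemma coe_node_succ_sub_coe_node (n : ℕ) : (node p q (n + 1) : ℝ) - node p q n = q := by
  rw [node_succ, NNReal.coe_add, add_sub_cancel_left]

variable {q}

lemma tendsto_node_atTop (hq : 0 < q) : Tendsto (node p q) atTop atTop :=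
  tendsto_atTop_mono (fun _ => le_add_self) (tendsto_natCast_atTop_atTop.const_mul_atTop hq)

end Nodes

section Discretization

/-- The discretization of `f` along the nodes `t_n = p + q n`: its value on `(t_n, t_(n+1)]` is
`f (t_(n+1))`, and it vanishes on `[0, p]`. -/
noncomputable def discretization {E : Type*} [NormedAddCommGroup E] (p q : ℝ≥0) (f : ℝ≥0 → E) :
    ℝ≥0 → E :=
  stepFunction (node p q) fun n => f (node p q (n + 1))

variable {E : Type*} [NormedAddCommGroup E]

lemma stronglyMeasurable_discretization (p q : ℝ≥0) (f : ℝ≥0 → E) :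
    StronglyMeasurable (discretization p q f) :=
  stronglyMeasurable_stepFunction (node_monotone p q)

variable {p q x : ℝ≥0} {f : ℝ≥0 → E}

lemma norm_discretization_le {C : ℝ} (hC : ∀ x, ‖f x‖ ≤ C) (x : ℝ≥0) :
    ‖discretization p q f x‖ ≤ C :=
  stepFunction_mem (node_monotone p q) (s := {z | ‖z‖ ≤ C})
    (by simpa using (norm_nonneg _).trans (hC 0)) (fun _ => hC _) x

lemma exists_discretization_eq (hq : 0 < q) (hx : p < x) :
    ∃ y ∈ Icc x (x + q), discretization p q f x = f y := by
  have hτ := node_monotone p q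
  obtain ⟨n, hn⟩ := exists_mem_Ioc_of_tendsto_atTop hτ (tendsto_node_atTop p hq)
    (by rwa [node_zero])
  refine ⟨node p q (n + 1), ⟨hn.2, ?_⟩, stepFunction_of_mem_Ioc hτ hn⟩
  rw [node_succ]
  gcongr
  exact hn.1.le

lemma tendsto_discretization {ι : Type*} {l : Filter ι} {q : ι → ℝ≥0} (hq : ∀ i, 0 < q i)
    (hlim : Tendsto q l (𝓝 0)) (hx : p < x) (hf : ContinuousAt f x) :
    Tendsto (fun i => discretization p (q i) f x) l (𝓝 (f x)) := by
  choose y hy heq using fun i => exists_discretization_eq (f := f) (hq i) hx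
  simp only [heq]
  refine hf.tendsto.comp (tendsto_of_tendsto_of_tendsto_of_le_of_le tendsto_const_nhds ?_
    (fun i => (hy i).1) fun i => (hy i).2)
  simpa only [add_zero] using hlim.const_add x

lemma tendsto_lintegral_enorm_sub_discretization {q : ℕ → ℝ≥0} (hq : ∀ n, 0 < q n)
    (hlim : Tendsto q atTop (𝓝 0)) (hf : Continuous f) {C : ℝ} (hC : ∀ x, ‖f x‖ ≤ C) (p T : ℝ≥0) :
    Tendsto (fun n => ∫⁻ x in Ioc p T, ‖f x - discretization p (q n) f x‖ₑ ∂lebesgue)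
      atTop (𝓝 0) := by
  have hfinite : IsFiniteMeasure (lebesgue.restrict (Ioc p T)) :=
    isFiniteMeasure_restrict.2 measure_Ioc_lt_top.ne
  have hpointwise : ∀ᵐ x ∂lebesgue.restrict (Ioc p T),
      Tendsto (fun n => discretization p (q n) f x) atTop (𝓝 (f x)) :=
    (ae_restrict_mem measurableSet_Ioc).mono fun x hx =>
      tendsto_discretization hq hlim hx.1 hf.continuousAt
  simpa only [ofReal_norm, enorm_sub_rev] using tendsto_lintegral_norm_of_dominated_convergence
    (bound := fun _ => C) (fun n => (stronglyMeasurable_discretization _ _ _).aestronglyMeasurable)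
    (integrable_const C).2 (fun n => ae_of_all _ (norm_discretization_le hC)) hpointwise

end Discretization

section ComplexLogarithm

variable {z w : ℂ}

lemma norm_exp_neg_sub_exp_neg_le (hz : 0 ≤ z.re) (hw : 0 ≤ w.re) :
    ‖Complex.exp (-z) - Complex.exp (-w)‖ ≤ ‖z - w‖ := by
  have hderiv (x : ℂ) : HasDerivAt (fun z => Complex.exp (-z)) (Complex.exp (-x) * (-1)) x :=
    (hasDerivAt_neg x).cexp
  have hbound (x : ℂ) (hx : 0 ≤ x.re) : ‖Complex.exp (-x) * (-1)‖ ≤ 1 := by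
    simpa [Complex.norm_exp] using hx
  simpa only [one_mul] using (convex_halfSpace_re_ge 0).norm_image_sub_le_of_norm_hasDerivWithin_le
    (fun x _ => (hderiv x).hasDerivWithinAt) hbound hw hz

lemma one_le_norm_one_add (hz : 0 ≤ z.re) : 1 ≤ ‖1 + z‖ :=
  calc 1 ≤ (1 + z).re := by simpa using hz
    _ ≤ ‖1 + z‖ := Complex.re_le_norm _

lemma norm_log_one_add_sub_le (hz : 0 ≤ z.re) (hw : 0 ≤ w.re) :
    ‖Complex.log (1 + z) - Complex.log (1 + w)‖ ≤ ‖z - w‖ := by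
  have hderiv (x : ℂ) (hx : 0 ≤ x.re) :
      HasDerivAt (fun z => Complex.log (1 + z)) (1 / (1 + x)) x :=
    ((hasDerivAt_id x).const_add 1).clog (.inl (by simpa using add_pos_of_pos_of_nonneg one_pos hx))
  have hbound (x : ℂ) (hx : 0 ≤ x.re) : ‖1 / (1 + x)‖ ≤ 1 := by
    simpa using inv_le_one_of_one_le₀ (one_le_norm_one_add hx)
  simpa only [one_mul] using (convex_halfSpace_re_ge 0).norm_image_sub_le_of_norm_hasDerivWithin_le
    (fun x hx => (hderiv x hx).hasDerivWithinAt) hbound hw hz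

lemma norm_log_one_add_le (hz : 0 ≤ z.re) : ‖Complex.log (1 + z)‖ ≤ ‖z‖ := by
  simpa using norm_log_one_add_sub_le hz (w := 0) le_rfl

lemma re_log_one_add_nonneg (hz : 0 ≤ z.re) : 0 ≤ (Complex.log (1 + z)).re := by
  rw [Complex.log_re]
  exact Real.log_nonneg (one_le_norm_one_add hz)

lemma norm_abs_re_add_im_mul_I_sub_le (hz : 0 ≤ z.re) (w : ℂ) :
    ‖z - (|w.re| + w.im * Complex.I)‖ ≤ ‖z - w‖ := by
  rw [Complex.norm_def, Complex.norm_def]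
  refine Real.sqrt_le_sqrt ?_
  simp only [Complex.normSq_apply, Complex.sub_re, Complex.sub_im, Complex.add_re, Complex.add_im,
    Complex.ofReal_re, Complex.ofReal_im, Complex.re_ofReal_mul, Complex.im_ofReal_mul,
    Complex.I_re, Complex.I_im, mul_zero, mul_one, zero_add, add_zero]
  nlinarith [mul_le_mul_of_nonneg_left (le_abs_self w.re) hz, abs_mul_abs_self w.re]

variable {α : Type*} [MeasurableSpace α] {μ : Measure α} {k : α → ℂ}

lemma integrable_log_one_add (hk : Integrable k μ) (hre : ∀ x, 0 ≤ (k x).re) :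
    Integrable (fun x => Complex.log (1 + k x)) μ :=
  hk.mono (Complex.measurable_log.comp_aemeasurable
    (hk.aemeasurable.const_add 1)).aestronglyMeasurable
    (ae_of_all _ fun x => norm_log_one_add_le (hre x))

lemma re_integral_nonneg (hre : ∀ x, 0 ≤ (k x).re) : 0 ≤ (∫ x, k x ∂μ).re := by
  by_cases hk : Integrable k μ
  · exact (integral_nonneg hre).trans_eq (integral_re hk)
  · simp [integral_undef hk]

lemma enorm_exp_neg_integral_sub_le {k' : α → ℂ} (hk : Integrable k μ) (hk' : Integrable k' μ)
    (hre : ∀ x, 0 ≤ (k x).re) (hre' : ∀ x, 0 ≤ (k' x).re) :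
    ‖Complex.exp (-∫ x, k x ∂μ) - Complex.exp (-∫ x, k' x ∂μ)‖ₑ ≤ ∫⁻ x, ‖k x - k' x‖ₑ ∂μ :=
  calc ‖Complex.exp (-∫ x, k x ∂μ) - Complex.exp (-∫ x, k' x ∂μ)‖ₑ
      ≤ ‖∫ x, (k x - k' x) ∂μ‖ₑ := by
        rw [enorm_le_iff_norm_le, integral_sub hk hk']
        exact norm_exp_neg_sub_exp_neg_le (re_integral_nonneg hre) (re_integral_nonneg hre')
    _ ≤ ∫⁻ x, ‖k x - k' x‖ₑ ∂μ := enorm_integral_le_lintegral_enorm _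

lemma enorm_exp_neg_integral_log_sub_le {k' : α → ℂ} (hk : Integrable k μ) (hk' : Integrable k' μ)
    (hre : ∀ x, 0 ≤ (k x).re) (hre' : ∀ x, 0 ≤ (k' x).re) :
    ‖Complex.exp (-∫ x, Complex.log (1 + k x) ∂μ) -
      Complex.exp (-∫ x, Complex.log (1 + k' x) ∂μ)‖ₑ ≤ ∫⁻ x, ‖k x - k' x‖ₑ ∂μ := by
  refine (enorm_exp_neg_integral_sub_le (integrable_log_one_add hk hre)
    (integrable_log_one_add hk' hre') (fun x => re_log_one_add_nonneg (hre x))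
    fun x => re_log_one_add_nonneg (hre' x)).trans (lintegral_mono fun x => ?_)
  exact enorm_le_iff_norm_le.2 (norm_log_one_add_sub_le (hre x) (hre' x))

end ComplexLogarithm

section LaplaceFunctional

namespace IsRegularGammaProcess

variable {Ω : Type*} [MeasurableSpace Ω] {P : Measure Ω} [IsProbabilityMeasure P]
  {S : ℝ≥0 → Ω → ℝ} (hS : IsRegularGammaProcess S P)
include hS

lemma integral_exp_neg_increment_smul {a b : ℝ≥0} (hab : a ≤ b) {z : ℂ} (hz : 0 ≤ z.re) :
    ∫ ω, Complex.exp (-((S b ω - S a ω) • z)) ∂P =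
      Complex.exp (-(((b : ℝ) - a) • Complex.log (1 + z))) := by
  rcases hab.eq_or_lt with rfl | hab
  · simp
  have hlaw := hS.law_increment a b hab
  have hmgf := complexMGF_id_gammaMeasure (sub_pos.2 (NNReal.coe_lt_coe.2 hab)) one_pos (z := -z)
    (by rw [Complex.neg_re]; linarith)
  have hne : 1 + z ≠ 0 := norm_pos_iff.1 (one_pos.trans_le (one_le_norm_one_add hz))
  calc ∫ ω, Complex.exp (-((S b ω - S a ω) • z)) ∂P
      = complexMGF id (gammaMeasure ((b : ℝ) - a) 1) (-z) := by
        rw [← hlaw.map_eq, complexMGF, integral_map hlaw.aemeasurable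
          (Continuous.aestronglyMeasurable (by fun_prop))]
        simp only [Complex.real_smul, id_eq, mul_neg, mul_comm]
    _ = Complex.exp (-(((b : ℝ) - a) • Complex.log (1 + z))) := by
        rw [hmgf, Complex.ofReal_one, div_one, sub_neg_eq_add, Complex.cpow_def_of_ne_zero hne,
          mul_neg, Complex.real_smul, mul_comm]

lemma integral_exp_neg_sum_increments {τ : ℕ → ℝ≥0} (hτ : Monotone τ) {c : ℕ → ℂ}
    (hc : ∀ j, 0 ≤ (c j).re) (n : ℕ) :
    ∫ ω, Complex.exp (-∑ j ∈ Finset.range n, (S (τ (j + 1)) ω - S (τ j) ω) • c j) ∂P =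
      Complex.exp (-∑ j ∈ Finset.range n,
        ((τ (j + 1) : ℝ) - τ j) • Complex.log (1 + c j)) := by
  have hindep := (hS.indep_increments.nat hτ).precomp
    (g := ((↑) : Finset.range n → ℕ)) Subtype.val_injective
  have hprod := hindep.integral_fun_prod_comp
    (f := fun (j : Finset.range n) (x : ℝ) => Complex.exp (-(x • c j)))
    (fun j => ((hS.measurable _).sub (hS.measurable _)).aemeasurable)
    (fun j => Continuous.aestronglyMeasurable (by fun_prop))
  simp only [← Finset.sum_neg_distrib, Complex.exp_sum, ← Finset.prod_coe_sort (Finset.range n)]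
  rw [hprod]
  exact Finset.prod_congr rfl fun j _ =>
    hS.integral_exp_neg_increment_smul (hτ (Nat.le_succ j)) (hc j)

lemma laplace_stepFunction {τ : ℕ → ℝ≥0} (hτ : Monotone τ) {c : ℕ → ℂ}
    (hc : ∀ j, 0 ≤ (c j).re) (n : ℕ) :
    ∫ ω, Complex.exp (-∫ x in Ioc (τ 0) (τ n), stepFunction τ c x
        ∂(pathMeasure fun u => S u ω)) ∂P =
      Complex.exp (-∫ x in Ioc (τ 0) (τ n), Complex.log (1 + stepFunction τ c x) ∂lebesgue) := by
  have hlog (x : ℝ≥0) : Complex.log (1 + stepFunction τ c x) =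
      stepFunction τ (fun j => Complex.log (1 + c j)) x :=
    apply_stepFunction hτ (g := fun z => Complex.log (1 + z)) (by simp) x
  simp only [hlog, setIntegral_stepFunction hτ, lebesgue_real_Ioc (hτ (Nat.le_succ _)),
    hS.pathMeasure_real_Ioc _ (hτ (Nat.le_succ _))]
  exact hS.integral_exp_neg_sum_increments hτ hc n

lemma integrable_exp_neg_integral {a b : ℝ≥0} {k : ℝ≥0 → ℂ} (hk : StronglyMeasurable k)
    (hre : ∀ x, 0 ≤ (k x).re) :
    Integrable (fun ω => Complex.exp (-∫ x in Ioc a b, k x ∂(pathMeasure fun u => S u ω))) P := by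
  refine .of_bound (C := 1) ?_ (ae_of_all _ fun ω => ?_)
  · exact (Complex.continuous_exp.comp continuous_neg).comp_aestronglyMeasurable
      (hS.stronglyMeasurable_integral_pathMeasure a b hk).aestronglyMeasurable
  · rw [Complex.norm_exp, Complex.neg_re, Real.exp_le_one_iff, neg_nonpos]
    exact re_integral_nonneg hre

lemma enorm_laplace_sub_le {a b : ℝ≥0} {k k' : ℝ≥0 → ℂ} (hk : StronglyMeasurable k)
    (hk' : StronglyMeasurable k') (hint : IntegrableOn k (Ioc a b) lebesgue)
    (hint' : IntegrableOn k' (Ioc a b) lebesgue) (hre : ∀ x, 0 ≤ (k x).re)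
    (hre' : ∀ x, 0 ≤ (k' x).re) :
    ‖∫ ω, Complex.exp (-∫ x in Ioc a b, k x ∂(pathMeasure fun u => S u ω)) ∂P -
      ∫ ω, Complex.exp (-∫ x in Ioc a b, k' x ∂(pathMeasure fun u => S u ω)) ∂P‖ₑ ≤
      ∫⁻ x in Ioc a b, ‖k x - k' x‖ₑ ∂lebesgue := by
  rw [← integral_sub (hS.integrable_exp_neg_integral hk hre)
    (hS.integrable_exp_neg_integral hk' hre')]
  refine (enorm_integral_le_lintegral_enorm _).trans (le_trans (lintegral_mono_ae ?_)
    (hS.lintegral_lintegral_pathMeasure a b (hk.sub hk').enorm).le)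
  filter_upwards [hS.ae_integrableOn_pathMeasure hk hint,
    hS.ae_integrableOn_pathMeasure hk' hint'] with ω hω hω'
  exact enorm_exp_neg_integral_sub_le hω hω' hre hre'

lemma laplace_of_forall_exists_approx {a b : ℝ≥0} {k : ℝ≥0 → ℂ} (hk : StronglyMeasurable k)
    (hint : IntegrableOn k (Ioc a b) lebesgue) (hre : ∀ x, 0 ≤ (k x).re)
    (happrox : ∀ ε : ℝ≥0∞, 0 < ε → ∃ k' : ℝ≥0 → ℂ, StronglyMeasurable k' ∧
      IntegrableOn k' (Ioc a b) lebesgue ∧ (∀ x, 0 ≤ (k' x).re) ∧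
      ∫⁻ x in Ioc a b, ‖k x - k' x‖ₑ ∂lebesgue ≤ ε ∧
      ∫ ω, Complex.exp (-∫ x in Ioc a b, k' x ∂(pathMeasure fun u => S u ω)) ∂P =
        Complex.exp (-∫ x in Ioc a b, Complex.log (1 + k' x) ∂lebesgue)) :
    ∫ ω, Complex.exp (-∫ x in Ioc a b, k x ∂(pathMeasure fun u => S u ω)) ∂P =
      Complex.exp (-∫ x in Ioc a b, Complex.log (1 + k x) ∂lebesgue) := by
  rw [← edist_eq_zero, ← nonpos_iff_eq_zero]
  refine le_of_forall_pos_le_add fun ε hε => ?_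
  obtain ⟨k', hk', hint', hre', hle, heq⟩ := happrox (ε / 2) (ENNReal.half_pos hε.ne')
  have hleft := (hS.enorm_laplace_sub_le hk hk' hint hint' hre hre').trans hle
  have hright := (enorm_exp_neg_integral_log_sub_le hint hint' hre hre').trans hle
  rw [← edist_eq_enorm_sub] at hleft hright
  rw [heq] at hleft
  rw [zero_add, ← ENNReal.add_halves ε]
  exact (edist_triangle_right _ _ _).trans (add_le_add hleft hright)

lemma laplace_of_continuous {a b : ℝ≥0} {k : ℝ≥0 → ℂ} (hk : Continuous k) {C : ℝ}
    (hC : ∀ x, ‖k x‖ ≤ C) (hre : ∀ x, 0 ≤ (k x).re) :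
    ∫ ω, Complex.exp (-∫ x in Ioc a b, k x ∂(pathMeasure fun u => S u ω)) ∂P =
      Complex.exp (-∫ x in Ioc a b, Complex.log (1 + k x) ∂lebesgue) := by
  rcases le_or_gt b a with hba | hab
  · simp [Ioc_eq_empty_of_le hba]
  set T := b - a
  have hT : 0 < T := tsub_pos_of_lt hab
  have hτ (n : ℕ) := node_monotone a (T / (n + 1))
  have hend (n : ℕ) : node a (T / (n + 1)) (n + 1) = b := by
    rw [node, Nat.cast_succ, div_mul_cancel₀ _ n.cast_add_one_ne_zero, add_tsub_cancel_of_le hab.le]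
  have hfinite : IsFiniteMeasure (lebesgue.restrict (Ioc a b)) :=
    isFiniteMeasure_restrict.2 measure_Ioc_lt_top.ne
  have hgrid : Tendsto (fun n : ℕ => T / (n + 1)) atTop (𝓝 0) := by
    simpa only [mul_one_div, mul_zero] using
      (tendsto_one_div_add_atTop_nhds_zero_nat (𝕜 := ℝ≥0)).const_mul T
  have hlim := tendsto_lintegral_enorm_sub_discretization (fun n => by positivity) hgrid hk hC a b
  refine hS.laplace_of_forall_exists_approx hk.stronglyMeasurable
    (Integrable.of_bound hk.aestronglyMeasurable C (ae_of_all _ hC)) hre fun ε hε => ?_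
  obtain ⟨n, hn⟩ := (hlim.eventually (ge_mem_nhds hε)).exists
  have hmeas := stronglyMeasurable_discretization a (T / (n + 1)) k
  have hre' := stepFunction_mem (hτ n) (c := fun j => k (node a (T / (n + 1)) (j + 1)))
    (s := {z : ℂ | 0 ≤ z.re}) (by simp) fun j => hre _
  refine ⟨_, hmeas, Integrable.of_bound hmeas.aestronglyMeasurable C
    (ae_of_all _ (norm_discretization_le hC)), hre', hn, ?_⟩
  have hlaplace := hS.laplace_stepFunction (hτ n) (c := fun j => k (node a (T / (n + 1)) (j + 1)))
    (fun j => hre _) (n + 1)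
  rwa [node_zero, hend] at hlaplace

theorem laplace {a b : ℝ≥0} {k : ℝ≥0 → ℂ} (hk : StronglyMeasurable k)
    (hint : IntegrableOn k (Ioc a b) lebesgue) (hre : ∀ x, 0 ≤ (k x).re) :
    ∫ ω, Complex.exp (-∫ x in Ioc a b, k x ∂(pathMeasure fun u => S u ω)) ∂P =
      Complex.exp (-∫ x in Ioc a b, Complex.log (1 + k x) ∂lebesgue) := by
  refine hS.laplace_of_forall_exists_approx hk hint hre fun ε hε => ?_
  have hfinite : IsFiniteMeasure (lebesgue.restrict (Ioc a b)) :=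
    isFiniteMeasure_restrict.2 measure_Ioc_lt_top.ne
  obtain ⟨g, hg, -⟩ := hint.exists_boundedContinuous_lintegral_sub_le hε.ne'
  -- Reflecting `g` into the right half-plane does not increase its distance to `k`.
  let g' : ℝ≥0 → ℂ := fun x => |(g x).re| + (g x).im * Complex.I
  have hcont : Continuous g' := by fun_prop
  have hre' (x : ℝ≥0) : 0 ≤ (g' x).re := by simp [g']
  have hbound (x : ℝ≥0) : ‖g' x‖ ≤ ‖g‖ := by
    have hle := norm_abs_re_add_im_mul_I_sub_le (z := 0) le_rfl (g x)
    simp only [zero_sub, norm_neg] at hle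
    exact hle.trans (g.norm_coe_le_norm x)
  refine ⟨g', hcont.stronglyMeasurable, Integrable.of_bound hcont.aestronglyMeasurable _
    (ae_of_all _ hbound), hre', (lintegral_mono fun x => ?_).trans hg,
    hS.laplace_of_continuous hcont hbound hre'⟩
  exact enorm_le_iff_norm_le.2 (norm_abs_re_add_im_mul_I_sub_le (hre x) (g x))

end IsRegularGammaProcess

end LaplaceFunctional

section JointLaw

/-- The integrals of `h` against the path `S · ω` over the successive blocks
`(τ j, τ (j + 1)]`. -/
noncomputable def blockIntegral {Ω : Type*} (S : ℝ≥0 → Ω → ℝ) (h : ℝ≥0 → ℝ) (τ : ℕ → ℝ≥0) (ω : Ω)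
    (j : ℕ) : ℝ :=
  ∫ x in Ioc (τ j) (τ (j + 1)), h x ∂(pathMeasure fun u => S u ω)

namespace IsRegularGammaProcess

variable {Ω : Type*} [MeasurableSpace Ω] {P : Measure Ω} {S : ℝ≥0 → Ω → ℝ}
  (hS : IsRegularGammaProcess S P) {h : ℝ≥0 → ℝ} (hh : StronglyMeasurable h) {τ : ℕ → ℝ≥0}
include hS hh

lemma measurable_blockIntegral (τ : ℕ → ℝ≥0) : Measurable (blockIntegral S h τ) :=
  measurable_pi_lambda _ fun _ => (hS.stronglyMeasurable_integral_pathMeasure _ _ hh).measurable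

lemma ae_sum_blockIntegral_eq (hint : ∀ T, IntegrableOn h (Ioc 0 T) lebesgue) (hτ : Monotone τ) :
    ∀ᵐ ω ∂P, ∀ n, ∑ j ∈ Finset.range n, blockIntegral S h τ ω j =
      ∫ x in Ioc (τ 0) (τ n), h x ∂(pathMeasure fun u => S u ω) := by
  filter_upwards [hS.ae_forall_integrableOn_pathMeasure hh hint] with ω hω n
  exact (setIntegral_Ioc_eq_sum hτ n ((hω (τ n)).mono_set (Ioc_subset_Ioc_left bot_le))).symm

variable [IsProbabilityMeasure P]

lemma integral_exp_I_mul_sum_blockIntegral {n : ℕ}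
    (hint : IntegrableOn h (Ioc (τ 0) (τ n)) lebesgue) (hτ : Monotone τ) (c : ℕ → ℝ) :
    ∫ ω, Complex.exp (Complex.I * ∑ j ∈ Finset.range n, c j * blockIntegral S h τ ω j) ∂P =
      Complex.exp (-∑ j ∈ Finset.range n, ∫ x in Ioc (τ j) (τ (j + 1)),
        Complex.log (1 + -Complex.I * (c j * h x : ℝ)) ∂lebesgue) := by
  let k (x : ℝ≥0) : ℂ := -Complex.I * (stepFunction τ c x • h x : ℝ)
  have hk_block (j : ℕ) : EqOn k (fun x => -Complex.I * (c j * h x : ℝ)) (Ioc (τ j) (τ (j + 1))) :=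
    fun x hx => by simp only [k, stepFunction_of_mem_Ioc hτ hx, smul_eq_mul]
  have hk_meas : StronglyMeasurable k := by
    have hsmul : StronglyMeasurable (stepFunction τ c • h) :=
      (stronglyMeasurable_stepFunction hτ).smul hh
    exact stronglyMeasurable_const.mul (Complex.continuous_ofReal.comp_stronglyMeasurable hsmul)
  have hk_re (x : ℝ≥0) : 0 ≤ (k x).re := by simp [k]
  have hk_int {μ : Measure ℝ≥0} (hμ : IntegrableOn h (Ioc (τ 0) (τ n)) μ) :
      IntegrableOn k (Ioc (τ 0) (τ n)) μ :=
    (integrableOn_stepFunction_smul hτ hμ).ofReal.const_mul _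
  have hright : ∫ x in Ioc (τ 0) (τ n), Complex.log (1 + k x) ∂lebesgue =
      ∑ j ∈ Finset.range n, ∫ x in Ioc (τ j) (τ (j + 1)),
        Complex.log (1 + -Complex.I * (c j * h x : ℝ)) ∂lebesgue := by
    rw [setIntegral_Ioc_eq_sum hτ n (integrable_log_one_add (hk_int hint) hk_re)]
    exact Finset.sum_congr rfl fun j _ => setIntegral_congr_fun measurableSet_Ioc fun x hx => by
      simp only [hk_block j hx]
  have hleft : ∀ᵐ ω ∂P, -∫ x in Ioc (τ 0) (τ n), k x ∂(pathMeasure fun u => S u ω) =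
      Complex.I * ∑ j ∈ Finset.range n, c j * blockIntegral S h τ ω j := by
    filter_upwards [hS.ae_integrableOn_pathMeasure hh hint] with ω hω
    rw [setIntegral_Ioc_eq_sum hτ n (hk_int hω), Complex.ofReal_sum, Finset.mul_sum,
      ← Finset.sum_neg_distrib]
    refine Finset.sum_congr rfl fun j _ => ?_
    rw [setIntegral_congr_fun measurableSet_Ioc (hk_block j), integral_const_mul,
      integral_complex_ofReal, integral_const_mul, blockIntegral, neg_mul, neg_neg,
      Complex.ofReal_mul]
  rw [← hright, ← hS.laplace hk_meas (hk_int hint) hk_re]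
  exact integral_congr_ae (hleft.mono fun ω hω => by simp only [hω])

omit hS hh [IsProbabilityMeasure P] in
lemma exists_forall_clm_restrict_eq_sum (I : Finset ℕ) (L : StrongDual ℝ (I → ℝ)) :
    ∃ (n : ℕ) (c : ℕ → ℝ), ∀ y : ℕ → ℝ, L (I.restrict y) = ∑ j ∈ Finset.range n, c j * y j := by
  obtain ⟨n, hn⟩ := I.exists_nat_subset_range
  let c (j : ℕ) : ℝ := if hj : j ∈ I then L (Pi.single ⟨j, hj⟩ 1) else 0
  refine ⟨n, c, fun y => ?_⟩
  have hbasis : I.restrict y = ∑ j : I, y j • (Pi.single j 1 : I → ℝ) := by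
    ext i
    simp [Finset.sum_apply, Pi.single_apply]
  rw [← Finset.sum_subset hn fun j _ hj => by simp [c, hj], ← Finset.sum_coe_sort I, hbasis,
    map_sum]
  exact Finset.sum_congr rfl fun j _ => by simp [c, mul_comm]

lemma charFunDual_map_restrict_blockIntegral (hint : ∀ T, IntegrableOn h (Ioc 0 T) lebesgue)
    (hτ : Monotone τ) {I : Finset ℕ} {L : StrongDual ℝ (I → ℝ)} {n : ℕ} {c : ℕ → ℝ}
    (hL : ∀ y : ℕ → ℝ, L (I.restrict y) = ∑ j ∈ Finset.range n, c j * y j) :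
    charFunDual (P.map (I.restrict ∘ blockIntegral S h τ)) L =
      Complex.exp (-∑ j ∈ Finset.range n, ∫ x in Ioc (τ j) (τ (j + 1)),
        Complex.log (1 + -Complex.I * (c j * h x : ℝ)) ∂lebesgue) := by
  rw [charFunDual_apply, integral_map ((Finset.measurable_restrict I).comp
    (hS.measurable_blockIntegral hh τ)).aemeasurable (by fun_prop),
    ← hS.integral_exp_I_mul_sum_blockIntegral hh
      ((hint (τ n)).mono_set (Ioc_subset_Ioc_left bot_le)) hτ]
  refine integral_congr_ae (ae_of_all _ fun ω => ?_)
  simp only [Function.comp_apply, hL, Complex.ofReal_sum, Complex.ofReal_mul, mul_comm Complex.I]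

variable {h' : ℝ≥0 → ℝ} {τ' : ℕ → ℝ≥0}

lemma identDistrib_blockIntegral (hh' : StronglyMeasurable h')
    (hint : ∀ T, IntegrableOn h (Ioc 0 T) lebesgue)
    (hint' : ∀ T, IntegrableOn h' (Ioc 0 T) lebesgue) (hτ : Monotone τ) (hτ' : Monotone τ')
    (hident : ∀ j, IdentDistrib h h' (lebesgue.restrict (Ioc (τ j) (τ (j + 1))))
      (lebesgue.restrict (Ioc (τ' j) (τ' (j + 1))))) :
    IdentDistrib (blockIntegral S h τ) (blockIntegral S h' τ') P P := by
  have hmeas := hS.measurable_blockIntegral hh τ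
  have hmeas' := hS.measurable_blockIntegral hh' τ'
  refine (identDistrib_iff_forall_finset_identDistrib (X := fun j ω => blockIntegral S h τ ω j)
    (Y := fun j ω => blockIntegral S h' τ' ω j)
    hmeas.aemeasurable hmeas'.aemeasurable).2 fun I => ?_
  have hmeasI := ((Finset.measurable_restrict I).comp hmeas).aemeasurable (μ := P)
  have hmeasI' := ((Finset.measurable_restrict I).comp hmeas').aemeasurable (μ := P)
  have := Measure.isProbabilityMeasure_map hmeasI
  have := Measure.isProbabilityMeasure_map hmeasI'
  refine ⟨hmeasI, hmeasI', Measure.ext_of_charFunDual (funext fun L => ?_)⟩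
  obtain ⟨n, c, hc⟩ := exists_forall_clm_restrict_eq_sum I L
  have hcf := hS.charFunDual_map_restrict_blockIntegral hh hint hτ hc
  have hcf' := hS.charFunDual_map_restrict_blockIntegral hh' hint' hτ' hc
  refine hcf.trans (Eq.trans ?_ hcf'.symm)
  congr 2
  exact Finset.sum_congr rfl fun j _ => ((hident j).comp
    (u := fun y => Complex.log (1 + -Complex.I * (c j * y : ℝ))) (by fun_prop)).integral_eq

lemma identDistrib_integral_pathMeasure (hh' : StronglyMeasurable h')
    (hint : ∀ T, IntegrableOn h (Ioc 0 T) lebesgue)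
    (hint' : ∀ T, IntegrableOn h' (Ioc 0 T) lebesgue) (hτ : Monotone τ) (hτ' : Monotone τ')
    (hident : ∀ j, IdentDistrib h h' (lebesgue.restrict (Ioc (τ j) (τ (j + 1))))
      (lebesgue.restrict (Ioc (τ' j) (τ' (j + 1))))) :
    IdentDistrib (fun ω n => ∫ x in Ioc (τ 0) (τ n), h x ∂(pathMeasure fun u => S u ω))
      (fun ω n => ∫ x in Ioc (τ' 0) (τ' n), h' x ∂(pathMeasure fun u => S u ω)) P P := by
  have hsum := (hS.identDistrib_blockIntegral hh hh' hint hint' hτ hτ' hident).comp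
    (u := fun y n => ∑ j ∈ Finset.range n, y j) (by fun_prop)
  refine ((IdentDistrib.of_ae_eq hsum.aemeasurable_fst ?_).symm.trans hsum).trans
    (IdentDistrib.of_ae_eq hsum.aemeasurable_snd ?_)
  · exact (hS.ae_sum_blockIntegral_eq hh hint hτ).mono fun ω hω => funext hω
  · exact (hS.ae_sum_blockIntegral_eq hh' hint' hτ').mono fun ω hω => funext hω

end IsRegularGammaProcess

end JointLaw

section Modes

namespace ConvMode

variable {Ω ι : Type*} [MeasurableSpace Ω] {P : Measure Ω} {m : ConvMode} {l : Filter ι}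

/-- The random variables `Z i` converge to `0` along the filter `l`, in the given mode. -/
def Null (m : ConvMode) (P : Measure Ω) (Z : ι → Ω → ℝ) (l : Filter ι) : Prop :=
  match m with
  | .inProbability => TendstoInMeasure P Z l fun _ => 0
  | .inLp r _ => Tendsto (fun i => eLpNorm (Z i) (r : ℝ≥0∞) P) l (𝓝 0)
  | .almostSure => ∀ᵐ ω ∂P, Tendsto (fun i => Z i ω) l (𝓝 0)

variable {X Y Z : ι → Ω → ℝ} {p : ι → Prop} {a b : ι → ℝ}

lemma tendstoOne_iff_null : m.TendstoOne P X l ↔ m.Null P (fun i ω => X i ω - 1) l := by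
  cases m with
  | inProbability => simp only [TendstoOne, Null, tendstoInMeasure_iff_norm, sub_zero]
  | inLp r hr => rfl
  | almostSure => simp only [TendstoOne, Null, tendsto_sub_nhds_zero_iff]

lemma Null.mono (hY : m.Null P Y l) (hp : ∀ᶠ i in l, p i)
    (hle : ∀ᵐ ω ∂P, ∀ i, p i → |X i ω| ≤ |Y i ω|) : m.Null P X l := by
  cases m with
  | inProbability =>
    simp only [Null, tendstoInMeasure_iff_norm, sub_zero] at hY ⊢
    refine fun ε hε => tendsto_of_tendsto_of_tendsto_of_le_of_le' tendsto_const_nhds (hY ε hε)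
      (Eventually.of_forall fun _ => bot_le) (hp.mono fun i hi => ?_)
    exact measure_mono_ae (hle.mono fun ω hω hX => le_trans hX (hω i hi))
  | inLp r hr =>
    exact tendsto_of_tendsto_of_tendsto_of_le_of_le' tendsto_const_nhds hY
      (Eventually.of_forall fun _ => bot_le)
      (hp.mono fun i hi => eLpNorm_mono_ae (hle.mono fun ω hω => hω i hi))
  | almostSure =>
    filter_upwards [hle, hY] with ω hω hYω
    exact squeeze_zero_norm' (hp.mono fun i hi => hω i hi)
      ((tendsto_zero_iff_abs_tendsto_zero _).1 hYω)

lemma tendstoOne_congr (hXY : ∀ᵐ ω ∂P, ∀ i, X i ω = Y i ω) :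
    m.TendstoOne P X l ↔ m.TendstoOne P Y l := by
  suffices himp : ∀ {X Y : ι → Ω → ℝ}, (∀ᵐ ω ∂P, ∀ i, X i ω = Y i ω) → m.TendstoOne P X l →
      m.TendstoOne P Y l from
    ⟨himp hXY, himp (hXY.mono fun ω hω i => (hω i).symm)⟩
  intro X Y hXY hX
  refine tendstoOne_iff_null.2 ((tendstoOne_iff_null.1 hX).mono (.of_forall fun _ => trivial)
    (hXY.mono fun ω hω i _ => ?_))
  rw [hω]

lemma Null.add (hX : m.Null P X l) (hY : m.Null P Y l) (hXm : ∀ i, AEStronglyMeasurable (X i) P)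
    (hYm : ∀ i, AEStronglyMeasurable (Y i) P) : m.Null P (fun i ω => X i ω + Y i ω) l := by
  cases m with
  | inProbability =>
    simp only [Null, tendstoInMeasure_iff_norm, sub_zero] at hX hY ⊢
    intro ε hε
    have hsum := (hX (ε / 2) (half_pos hε)).add (hY (ε / 2) (half_pos hε))
    rw [add_zero] at hsum
    refine tendsto_of_tendsto_of_tendsto_of_le_of_le tendsto_const_nhds hsum
      (fun _ => bot_le) fun i => (measure_mono fun ω hω => ?_).trans (measure_union_le _ _)
    by_contra! hlt
    simp only [mem_union, mem_ofPred_eq, not_or, not_le] at hω hlt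
    linarith [norm_add_le (X i ω) (Y i ω)]
  | inLp r hr =>
    have hsum := ENNReal.Tendsto.const_mul (a := ENNReal.LpAddConst r) (Tendsto.add hX hY)
      (Or.inr (ENNReal.LpAddConst_lt_top _).ne)
    rw [add_zero, mul_zero] at hsum
    exact tendsto_of_tendsto_of_tendsto_of_le_of_le tendsto_const_nhds hsum (fun _ => bot_le)
      fun i => eLpNorm_add_le' (hXm i) (hYm i) _
  | almostSure =>
    filter_upwards [hX, hY] with ω hXω hYω
    simpa only [add_zero] using hXω.add hYω

lemma TendstoOne.comp {κ : Type*} {l' : Filter κ} (hX : m.TendstoOne P X l) {φ : κ → ι}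
    (hφ : Tendsto φ l' l) : m.TendstoOne P (fun i => X (φ i)) l' := by
  cases m with
  | inProbability => exact TendstoInMeasure.comp hX hφ
  | inLp r hr => exact Tendsto.comp (g := fun i => eLpNorm (fun ω => X i ω - 1) r P) hX hφ
  | almostSure => exact Eventually.mono hX fun ω hω => hω.comp hφ

lemma null_inProbability_of_null [IsFiniteMeasure P] {X : ℕ → Ω → ℝ} (hX : m.Null P X atTop)
    (hXm : ∀ i, AEStronglyMeasurable (X i) P) : inProbability.Null P X atTop := by
  cases m with
  | inProbability => exact hX
  | inLp r hr =>
    exact tendstoInMeasure_of_tendsto_eLpNorm (p := r) (mod_cast hr.ne') hXm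
      aestronglyMeasurable_zero (hX.congr fun i => by simp only [Pi.sub_def, sub_zero])
  | almostSure => exact tendstoInMeasure_of_tendsto_ae hXm hX

lemma null_mul_of_memLp {Y : Ω → ℝ} (hY : ∀ r : ℝ≥0, MemLp Y r P) {c : ι → ℝ}
    (hc : Tendsto c l (𝓝 0)) : m.Null P (fun i ω => c i * Y ω) l := by
  have hLp (r : ℝ≥0) : Tendsto (fun i => eLpNorm (fun ω => c i * Y ω) r P) l (𝓝 0) := by
    have hmul := ENNReal.Tendsto.mul_const (b := eLpNorm Y r P) hc.enorm (Or.inr (hY r).2.ne)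
    rw [enorm_zero, zero_mul] at hmul
    exact hmul.congr fun i => (eLpNorm_const_smul (c i) Y _ P).symm
  cases m with
  | inProbability =>
    exact tendstoInMeasure_of_tendsto_eLpNorm one_ne_zero (fun i => (hY 1).1.const_mul (c i))
      aestronglyMeasurable_const ((hLp 1).congr fun i => by simp [Pi.sub_def])
  | inLp r hr => exact hLp r
  | almostSure => exact ae_of_all _ fun ω => by simpa only [zero_mul] using hc.mul_const (Y ω)

lemma Null.of_identDistrib {X Y : ℕ → Ω → ℝ} (hX : m.Null P X atTop)
    (hlaw : IdentDistrib (fun ω n => X n ω) (fun ω n => Y n ω) P P) : m.Null P Y atTop := by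
  have hlaw_apply (n : ℕ) : IdentDistrib (X n) (Y n) P P := hlaw.comp (measurable_pi_apply n)
  cases m with
  | inProbability =>
    simp only [Null, tendstoInMeasure_iff_norm, sub_zero] at hX ⊢
    exact fun ε hε => (hX ε hε).congr fun n => (hlaw_apply n).measure_mem_eq
      (measurableSet_le measurable_const measurable_norm)
  | inLp r hr => exact Tendsto.congr (fun n => (hlaw_apply n).eLpNorm_eq _) hX
  | almostSure =>
    exact hlaw.ae_snd (p := fun x : ℕ → ℝ => Tendsto x atTop (𝓝 0))
      (measurableSet_tendsto _ measurable_pi_apply) hX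

lemma tendstoOne_div_congr_of_identDistrib {X Y : ℕ → Ω → ℝ}
    (hlaw : IdentDistrib (fun ω n => X n ω) (fun ω n => Y n ω) P P) (a : ℕ → ℝ) :
    m.TendstoOne P (fun n ω => X n ω / a n) atTop ↔
      m.TendstoOne P (fun n ω => Y n ω / a n) atTop := by
  have hratio := hlaw.comp (u := fun (y : ℕ → ℝ) n => y n / a n - 1) (by fun_prop)
  rw [tendstoOne_iff_null, tendstoOne_iff_null]
  exact ⟨fun hX => hX.of_identDistrib hratio, fun hY => hY.of_identDistrib hratio.symm⟩

/-- `X ≲ Y` at the scale `a`: in the given mode, the excess of `X` over `Y` is negligible with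
respect to `a`. -/
def AsympLE (m : ConvMode) (P : Measure Ω) (a : ι → ℝ) (X Y : ι → Ω → ℝ) (l : Filter ι) : Prop :=
  m.Null P (fun i ω => (X i ω - Y i ω)⁺ / a i) l

lemma aestronglyMeasurable_posPart_sub_div (hX : ∀ i, AEStronglyMeasurable (X i) P)
    (hY : ∀ i, AEStronglyMeasurable (Y i) P) (a : ι → ℝ) (i : ι) :
    AEStronglyMeasurable (fun ω => (X i ω - Y i ω)⁺ / a i) P := by
  simp only [div_eq_inv_mul]
  exact (continuous_posPart.comp_aestronglyMeasurable ((hX i).sub (hY i))).const_mul _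

lemma AsympLE.trans (hXY : m.AsympLE P a X Y l) (hYZ : m.AsympLE P a Y Z l)
    (hX : ∀ i, AEStronglyMeasurable (X i) P) (hY : ∀ i, AEStronglyMeasurable (Y i) P)
    (hZ : ∀ i, AEStronglyMeasurable (Z i) P) : m.AsympLE P a X Z l := by
  refine (Null.add hXY hYZ (aestronglyMeasurable_posPart_sub_div hX hY a)
    (aestronglyMeasurable_posPart_sub_div hY hZ a)).mono (Eventually.of_forall fun _ => trivial)
    (ae_of_all _ fun ω i _ => ?_)
  have hsub : (X i ω - Z i ω)⁺ ≤ (X i ω - Y i ω)⁺ + (Y i ω - Z i ω)⁺ :=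
    sup_le (by linarith [le_posPart (X i ω - Y i ω), le_posPart (Y i ω - Z i ω)])
      (add_nonneg (posPart_nonneg _) (posPart_nonneg _))
  rw [← add_div, abs_div, abs_div, abs_of_nonneg (posPart_nonneg _),
    abs_of_nonneg ((posPart_nonneg _).trans hsub)]
  gcongr

lemma AsympLE.of_identDistrib {X Y X' Y' : ℕ → Ω → ℝ} {a : ℕ → ℝ}
    (hXY : m.AsympLE P a X Y atTop) (hlaw : IdentDistrib (fun ω n => (X n ω, Y n ω))
      (fun ω n => (X' n ω, Y' n ω)) P P) : m.AsympLE P a X' Y' atTop :=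
  Null.of_identDistrib hXY <| hlaw.comp
    (u := fun (y : ℕ → ℝ × ℝ) n => ((y n).1 - (y n).2)⁺ / a n) <| measurable_pi_lambda _ fun n =>
      (continuous_posPart.measurable.comp (by fun_prop)).div_const _

lemma asympLE_of_le_add {W : Ω → ℝ} (ha : Tendsto a l atTop) (hW : ∀ r : ℝ≥0, MemLp W r P)
    (hp : ∀ᶠ i in l, p i) (hle : ∀ᵐ ω ∂P, ∀ i, p i → X i ω ≤ Y i ω + W ω) :
    m.AsympLE P a X Y l := by
  refine (null_mul_of_memLp hW ha.inv_tendsto_atTop).mono hp (hle.mono fun ω hω i hi => ?_)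
  have hexcess : (X i ω - Y i ω)⁺ ≤ |W ω| :=
    sup_le ((sub_le_iff_le_add'.2 (hω i hi)).trans (le_abs_self _)) (abs_nonneg _)
  rw [abs_div, abs_of_nonneg (posPart_nonneg _), Pi.inv_apply, ← div_eq_inv_mul, abs_div]
  gcongr

lemma asympLE_of_le (ha : Tendsto a l atTop) (hp : ∀ᶠ i in l, p i)
    (hle : ∀ᵐ ω ∂P, ∀ i, p i → X i ω ≤ Y i ω) : m.AsympLE P a X Y l :=
  asympLE_of_le_add (W := 0) ha (fun _ => MemLp.zero) hp (by simpa using hle)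

lemma asympLE_of_isEquivalent [IsFiniteMeasure P] (ha : Tendsto a l atTop)
    {c d : ι → ℝ} (hc : Asymptotics.IsEquivalent l c a) (hd : Asymptotics.IsEquivalent l d a) :
    m.AsympLE P a (fun i _ => c i) (fun i _ => d i) l := by
  have hdiv {e : ι → ℝ} (he : Asymptotics.IsEquivalent l e a) :
      Tendsto (fun i => e i / a i) l (𝓝 1) :=
    (Asymptotics.isEquivalent_iff_tendsto_one (ha.eventually_ne_atTop 0)).1 he
  have hsub : Tendsto (fun i => c i / a i - d i / a i) l (𝓝 0) := by
    simpa only [sub_self] using (hdiv hc).sub (hdiv hd)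
  refine (null_mul_of_memLp (fun r => memLp_const (1 : ℝ)) hsub).mono
    (Eventually.of_forall fun _ => trivial) (ae_of_all _ fun ω i _ => ?_)
  rw [mul_one, ← sub_div, abs_div, abs_div, abs_of_nonneg (posPart_nonneg _)]
  gcongr
  exact sup_le (le_abs_self _) (abs_nonneg _)

lemma AsympLE.of_isEquivalent (hXY : m.AsympLE P a X Y l)
    (hab : Asymptotics.IsEquivalent l a b) (hX : ∀ i, AEStronglyMeasurable (X i) P)
    (hY : ∀ i, AEStronglyMeasurable (Y i) P) : m.AsympLE P b X Y l := by
  have hmeas := aestronglyMeasurable_posPart_sub_div hX hY a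
  have hinv : ∀ᶠ i in l, |(b i)⁻¹ - (a i)⁻¹| ≤ |(a i)⁻¹| :=
    (hab.symm.inv.isLittleO.def one_pos).mono fun i hi => by simpa using hi
  refine (Null.add hXY hXY hmeas hmeas).mono hinv (ae_of_all _ fun ω i hi => ?_)
  have hb : |(b i)⁻¹| ≤ 2 * |(a i)⁻¹| := by
    linarith [abs_sub_abs_le_abs_sub (b i)⁻¹ (a i)⁻¹]
  rw [← two_mul, abs_mul, div_eq_mul_inv, div_eq_mul_inv, abs_mul, abs_mul, abs_two]
  nlinarith [abs_nonneg (X i ω - Y i ω)⁺]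

lemma tendstoOne_div_iff (ha : Tendsto a l atTop) (hX : ∀ i, AEStronglyMeasurable (X i) P) :
    m.TendstoOne P (fun i ω => X i ω / a i) l ↔
      m.AsympLE P a X (fun i _ => a i) l ∧ m.AsympLE P a (fun i _ => a i) X l := by
  have hsub_div {i : ι} (hi : 0 < a i) (ω : Ω) : X i ω / a i - 1 = (X i ω - a i) / a i := by
    field_simp
  rw [tendstoOne_iff_null]
  refine ⟨fun h => ⟨?_, ?_⟩, fun ⟨hle, hge⟩ => ?_⟩
  · refine h.mono (ha.eventually_gt_atTop 0) (ae_of_all _ fun ω i hi => ?_)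
    rw [hsub_div hi, abs_div, abs_div, abs_of_nonneg (posPart_nonneg _)]
    gcongr
    exact sup_le (le_abs_self _) (abs_nonneg _)
  · refine h.mono (ha.eventually_gt_atTop 0) (ae_of_all _ fun ω i hi => ?_)
    rw [hsub_div hi, abs_div, abs_div, abs_of_nonneg (posPart_nonneg _), abs_sub_comm]
    gcongr
    exact sup_le (le_abs_self _) (abs_nonneg _)
  · have hconst (i : ι) : AEStronglyMeasurable (fun _ : Ω => a i) P := aestronglyMeasurable_const
    refine (Null.add hle hge (aestronglyMeasurable_posPart_sub_div hX hconst a)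
      (aestronglyMeasurable_posPart_sub_div hconst hX a)).mono (ha.eventually_gt_atTop 0)
      (ae_of_all _ fun ω i hi => ?_)
    rw [hsub_div hi, ← add_div, abs_div, abs_div, ← neg_sub (X i ω), posPart_neg,
      posPart_add_negPart, abs_abs]

lemma tendstoOne_div_congr [IsFiniteMeasure P] (ha : Tendsto a l atTop)
    (hab : Asymptotics.IsEquivalent l a b) (hX : ∀ i, AEStronglyMeasurable (X i) P) :
    m.TendstoOne P (fun i ω => X i ω / a i) l ↔ m.TendstoOne P (fun i ω => X i ω / b i) l := by
  wlog h : m.TendstoOne P (fun i ω => X i ω / a i) l generalizing a b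
  · exact ⟨fun h' => absurd h' h, fun h' =>
      (this (hab.tendsto_atTop ha) hab.symm h').1 h'⟩
  refine iff_of_true h ?_
  have hconst (c : ι → ℝ) (i : ι) : AEStronglyMeasurable (fun _ : Ω => c i) P :=
    aestronglyMeasurable_const
  have hb := hab.tendsto_atTop ha
  obtain ⟨hle, hge⟩ := (tendstoOne_div_iff ha hX).1 h
  refine (tendstoOne_div_iff hb hX).2 ⟨?_, ?_⟩
  · exact (hle.of_isEquivalent hab hX (hconst a)).trans
      (asympLE_of_isEquivalent hb hab .refl) hX (hconst a) (hconst b)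
  · exact (asympLE_of_isEquivalent hb .refl hab).trans
      (hge.of_isEquivalent hab (hconst a) hX) (hconst b) (hconst a) hX

lemma tendstoOne_comp_succ_iff {X : ℕ → Ω → ℝ} :
    m.TendstoOne P (fun n => X (n + 1)) atTop ↔ m.TendstoOne P X atTop := by
  cases m with
  | inProbability =>
    exact forall₂_congr fun ε _ =>
      tendsto_add_atTop_iff_nat (f := fun n => P {ω | ε ≤ edist (X n ω) 1}) 1
  | inLp r hr =>
    exact tendsto_add_atTop_iff_nat (f := fun n => eLpNorm (fun ω => X n ω - 1) r P) 1
  | almostSure =>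
    exact eventually_congr <| .of_forall fun ω => tendsto_add_atTop_iff_nat (f := fun n => X n ω) 1

section Sandwich

variable [IsFiniteMeasure P] {X U V : ℕ → Ω → ℝ} {W : Ω → ℝ} {a : ℕ → ℝ}
  (ha : Tendsto a atTop atTop) (hsucc : Asymptotics.IsEquivalent atTop (fun n => a (n + 1)) a)
  (hX : ∀ n, AEStronglyMeasurable (X n) P)
include ha hsucc hX

lemma tendstoOne_succ_div_iff : m.TendstoOne P (fun n ω => X (n + 1) ω / a n) atTop ↔
    m.TendstoOne P (fun n ω => X n ω / a n) atTop :=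
  (tendstoOne_div_congr (ha.comp (tendsto_add_atTop_nat 1)) hsucc fun n => hX (n + 1)).symm.trans
    (tendstoOne_comp_succ_iff (X := fun n ω => X n ω / a n))

lemma tendstoOne_div_iff_of_sandwich (hW : ∀ r : ℝ≥0, MemLp W r P)
    (hlaw : IdentDistrib (fun ω n => U n ω) (fun ω n => V n ω) P P)
    (hUX : ∀ᵐ ω ∂P, ∀ n, U n ω ≤ X (n + 1) ω) (hXV : ∀ᵐ ω ∂P, ∀ n, X n ω ≤ V n ω + W ω) :
    m.TendstoOne P (fun n ω => X n ω / a n) atTop ↔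
      m.TendstoOne P (fun n ω => U n ω / a n) atTop := by
  have hconst (n : ℕ) : AEStronglyMeasurable (fun _ : Ω => a n) P := aestronglyMeasurable_const
  have hU (n : ℕ) : AEStronglyMeasurable (U n) P :=
    (hlaw.comp (measurable_pi_apply n)).aemeasurable_fst.aestronglyMeasurable
  have hV (n : ℕ) : AEStronglyMeasurable (V n) P :=
    (hlaw.comp (measurable_pi_apply n)).aemeasurable_snd.aestronglyMeasurable
  have hUX' : m.AsympLE P a U (fun n => X (n + 1)) atTop :=
    asympLE_of_le ha (.of_forall fun _ => trivial) (hUX.mono fun ω hω n _ => hω n)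
  constructor <;> intro h
  · have hle := ((tendstoOne_div_iff ha fun n => hX (n + 1)).1
      ((tendstoOne_succ_div_iff ha hsucc hX).2 h)).1
    have hXV' : m.AsympLE P a X V atTop :=
      asympLE_of_le_add ha hW (.of_forall fun _ => trivial) (hXV.mono fun ω hω n _ => hω n)
    have hge := ((tendstoOne_div_iff ha hX).1 h).2.trans hXV' hconst hX hV
    exact (tendstoOne_div_iff ha hU).2 ⟨hUX'.trans hle hU (fun n => hX (n + 1)) hconst,
      hge.of_identDistrib (hlaw.symm.comp (u := fun (y : ℕ → ℝ) n => (a n, y n)) (by fun_prop))⟩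
  · have hVone := (tendstoOne_div_congr_of_identDistrib hlaw a).1 h
    have hle := ((tendstoOne_div_iff ha fun n => hV (n + 1)).1
      ((tendstoOne_succ_div_iff ha hsucc hV).2 hVone)).1
    have hXV' : m.AsympLE P a (fun n => X (n + 1)) (fun n => V (n + 1)) atTop :=
      asympLE_of_le_add ha hW (.of_forall fun _ => trivial) (hXV.mono fun ω hω n _ => hω (n + 1))
    refine (tendstoOne_succ_div_iff ha hsucc hX).1
      ((tendstoOne_div_iff ha fun n => hX (n + 1)).2 ⟨?_, ?_⟩)
    · exact hXV'.trans hle (fun n => hX (n + 1)) (fun n => hV (n + 1)) hconst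
    · exact ((tendstoOne_div_iff ha hU).1 h).2.trans hUX' hconst hU (fun n => hX (n + 1))

end Sandwich

end ConvMode

end Modes

section NegligibleIncrements

section Cumul

variable {h : ℝ≥0 → ℝ}

lemma cumul_nonneg (h0 : ∀ x, 0 ≤ h x) (t : ℝ≥0) : 0 ≤ cumul h t := integral_nonneg h0

lemma cumul_mono (h0 : ∀ x, 0 ≤ h x) (hint : ∀ T, IntegrableOn h (Ioc 0 T) lebesgue) :
    Monotone (cumul h) := fun _ t hst =>
  setIntegral_mono_set (hint t) (ae_of_all _ h0) (Ioc_subset_Ioc_right hst).eventuallyLE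

lemma cumul_sub_cumul (hint : ∀ T, IntegrableOn h (Ioc 0 T) lebesgue) {s t : ℝ≥0} (hst : s ≤ t) :
    cumul h t - cumul h s = ∫ x in Ioc s t, h x ∂lebesgue := by
  rw [sub_eq_iff_eq_add']
  exact (setIntegral_Ioc_add_setIntegral_Ioc bot_le hst (hint t)).symm

end Cumul

section LogarithmicDefect

lemma log_one_add_le_self {u : ℝ} (hu : 0 ≤ u) : Real.log (1 + u) ≤ u := by
  linarith [Real.log_le_sub_one_of_pos (show 0 < 1 + u by linarith)]

lemma le_add_mul_sub_log_one_add {u δ : ℝ} (hu : 0 ≤ u) (hδ : 0 < δ) :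
    u ≤ δ + (1 + δ) / δ * (u - Real.log (1 + u)) := by
  have htangent : Real.log (1 + u) ≤ δ + (u - δ) / (1 + δ) := by
    have hquot := Real.log_le_sub_one_of_pos (show 0 < (1 + u) / (1 + δ) by positivity)
    rw [Real.log_div (by positivity) (by positivity)] at hquot
    calc Real.log (1 + u) ≤ Real.log (1 + δ) + ((1 + u) / (1 + δ) - 1) := by linarith
      _ ≤ δ + ((1 + u) / (1 + δ) - 1) := by gcongr; exact log_one_add_le_self hδ.le
      _ = δ + (u - δ) / (1 + δ) := by field_simp; ring
  calc u = δ + (1 + δ) / δ * (u - (δ + (u - δ) / (1 + δ))) := by field_simp; ring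
    _ ≤ δ + (1 + δ) / δ * (u - Real.log (1 + u)) := by gcongr

variable {α : Type*} [MeasurableSpace α] {μ : Measure α}

lemma integrable_log_one_add_of_nonneg {u : α → ℝ} (hu : Integrable u μ) (h0 : ∀ x, 0 ≤ u x) :
    Integrable (fun x => Real.log (1 + u x)) μ := by
  refine hu.mono ((hu.1.aemeasurable.const_add 1).log.aestronglyMeasurable)
    (ae_of_all _ fun x => ?_)
  rw [Real.norm_of_nonneg (h0 x), Real.norm_of_nonneg (Real.log_nonneg (by linarith [h0 x]))]
  exact log_one_add_le_self (h0 x)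

lemma setIntegral_le_add_mul_integral_sub_log {u : α → ℝ} {s t : Set α} (hts : t ⊆ s)
    (ht : μ t ≠ ∞) (hu : IntegrableOn u s μ) (h0 : ∀ x, 0 ≤ u x) {δ : ℝ} (hδ : 0 < δ) :
    ∫ x in t, u x ∂μ ≤ δ * μ.real t +
      (1 + δ) / δ * (∫ x in s, u x ∂μ - ∫ x in s, Real.log (1 + u x) ∂μ) := by
  have hlog := integrable_log_one_add_of_nonneg hu h0
  have hdefect : IntegrableOn (fun x => u x - Real.log (1 + u x)) s μ := hu.sub hlog
  have hconst : IntegrableOn (fun _ => δ) t μ := integrableOn_const ht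
  calc ∫ x in t, u x ∂μ
      ≤ ∫ x in t, (δ + (1 + δ) / δ * (u x - Real.log (1 + u x))) ∂μ :=
        integral_mono (hu.mono_set hts) (hconst.add ((hdefect.mono_set hts).const_mul _))
          fun x => le_add_mul_sub_log_one_add (h0 x) hδ
    _ = δ * μ.real t + (1 + δ) / δ * ∫ x in t, (u x - Real.log (1 + u x)) ∂μ := by
        rw [integral_add hconst ((hdefect.mono_set hts).const_mul _), setIntegral_const,
          integral_const_mul, smul_eq_mul, mul_comm δ]
    _ ≤ δ * μ.real t + (1 + δ) / δ * ∫ x in s, (u x - Real.log (1 + u x)) ∂μ := by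
        gcongr
        exact ae_of_all _ fun x => sub_nonneg.2 (log_one_add_le_self (h0 x))
    _ = _ := by rw [integral_sub hu hlog]

end LogarithmicDefect

variable {Ω : Type*} [MeasurableSpace Ω] {P : Measure Ω} {S : ℝ≥0 → Ω → ℝ}

lemma tendsto_integral_exp_neg_of_tendstoInMeasure [IsProbabilityMeasure P] {R : ℕ → Ω → ℝ} {c : ℝ}
    (hmeas : ∀ n, AEStronglyMeasurable (R n) P) (h0 : ∀ n ω, 0 ≤ R n ω)
    (hR : TendstoInMeasure P R atTop fun _ => c) :
    Tendsto (fun n => ∫ ω, Real.exp (-R n ω) ∂P) atTop (𝓝 (Real.exp (-c))) := by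
  refine tendsto_of_subseq_tendsto fun ns hns => ?_
  obtain ⟨ms, -, hms⟩ := (hR.comp hns).exists_seq_tendsto_ae
  have hlim : ∫ _, Real.exp (-c) ∂P = Real.exp (-c) := by simp
  refine ⟨ms, hlim ▸ tendsto_integral_of_dominated_convergence (fun _ => 1)
    (fun n => Real.continuous_exp.comp_aestronglyMeasurable (hmeas _).neg) (integrable_const _)
    (fun n => ae_of_all _ fun ω => ?_) ?_⟩
  · rw [Real.norm_eq_abs, Real.abs_exp]
    exact Real.exp_le_one_iff.2 (neg_nonpos.2 (h0 _ _))
  · exact hms.mono fun ω hω => (Real.continuous_exp.tendsto _).comp hω.neg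

namespace IsRegularGammaProcess

variable (hS : IsRegularGammaProcess S P) {h : ℝ≥0 → ℝ} (hh : StronglyMeasurable h)
include hS hh

lemma stronglyMeasurable_gammaIntegral (T : ℝ≥0) : StronglyMeasurable (gammaIntegral S h T) :=
  hS.stronglyMeasurable_integral_pathMeasure 0 T hh

lemma stronglyMeasurable_gammaRatio (T : ℝ≥0) : StronglyMeasurable (gammaRatio S h T) :=
  ((hS.stronglyMeasurable_gammaIntegral hh T).measurable.div_const _).stronglyMeasurable

variable [IsProbabilityMeasure P] (h0 : ∀ x, 0 ≤ h x)
include h0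

lemma integral_exp_neg_mul_gammaIntegral {T : ℝ≥0} (hint : IntegrableOn h (Ioc 0 T) lebesgue)
    {c : ℝ} (hc : 0 ≤ c) : ∫ ω, Real.exp (-(c * gammaIntegral S h T ω)) ∂P =
      Real.exp (-∫ x in Ioc 0 T, Real.log (1 + c * h x) ∂lebesgue) := by
  have hlog (x : ℝ≥0) : Complex.log (1 + (c * h x : ℝ)) = (Real.log (1 + c * h x) : ℝ) := by
    rw [Complex.ofReal_log (by linarith [mul_nonneg hc (h0 x)]), Complex.ofReal_add,
      Complex.ofReal_one]
  have hlaplace := hS.laplace (k := fun x => ((c * h x : ℝ) : ℂ))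
    (Complex.continuous_ofReal.comp_stronglyMeasurable (stronglyMeasurable_const.mul hh))
    (hint.const_mul c).ofReal fun x => mul_nonneg hc (h0 x)
  simp only [hlog, integral_complex_ofReal, integral_const_mul, ← Complex.ofReal_neg,
    ← Complex.ofReal_exp] at hlaplace
  exact_mod_cast hlaplace

variable (hint : ∀ T, IntegrableOn h (Ioc 0 T) lebesgue) {τ : ℕ → ℝ≥0}
include hint

lemma tendsto_integral_log_one_add_div_cumul
    (hR : TendstoInMeasure P (fun n => gammaRatio S h (τ n)) atTop fun _ => 1) :
    Tendsto (fun n => ∫ x in Ioc 0 (τ n), Real.log (1 + (cumul h (τ n))⁻¹ * h x) ∂lebesgue)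
      atTop (𝓝 1) := by
  have hexp := tendsto_integral_exp_neg_of_tendstoInMeasure
    (fun n => (hS.stronglyMeasurable_gammaRatio hh (τ n)).aestronglyMeasurable)
    (fun n ω => div_nonneg (integral_nonneg h0) (cumul_nonneg h0 _)) hR
  have hlaplace (n : ℕ) := hS.integral_exp_neg_mul_gammaIntegral hh h0 (hint (τ n))
    (inv_nonneg.2 (cumul_nonneg h0 (τ n)))
  simp only [gammaRatio, div_eq_inv_mul, hlaplace] at hexp
  simpa [Function.comp_def] using
    ((Real.continuousAt_log (Real.exp_pos (-1)).ne').tendsto.comp hexp).neg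

theorem isEquivalent_cumul_succ (hτ : Monotone τ) {C : ℝ≥0} (hgap : ∀ n, τ (n + 1) ≤ τ n + C)
    (hdiv : Tendsto (fun n => cumul h (τ n)) atTop atTop)
    (hR : TendstoInMeasure P (fun n => gammaRatio S h (τ n)) atTop fun _ => 1) :
    Asymptotics.IsEquivalent atTop (fun n => cumul h (τ (n + 1))) fun n => cumul h (τ n) := by
  refine Asymptotics.IsEquivalent.symm (Asymptotics.isLittleO_iff.2 fun ε hε => ?_)
  obtain ⟨δ, hδ, hδC⟩ : ∃ δ : ℝ, 0 < δ ∧ δ * C < ε :=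
    ⟨ε / (C + 1), by positivity, by rw [div_mul_eq_mul_div, div_lt_iff₀ (by positivity)]; nlinarith⟩
  have hbound : Tendsto (fun n => δ * C + (1 + δ) / δ * (1 - ∫ x in Ioc 0 (τ (n + 1)),
      Real.log (1 + (cumul h (τ (n + 1)))⁻¹ * h x) ∂lebesgue)) atTop (𝓝 (δ * C)) := by
    simpa using (((((tendsto_add_atTop_iff_nat 1).2 (hS.tendsto_integral_log_one_add_div_cumul hh h0
      hint hR)).const_sub 1).const_mul ((1 + δ) / δ)).const_add (δ * C))
  filter_upwards [hbound.eventually (gt_mem_nhds hδC),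
    ((tendsto_add_atTop_iff_nat 1).2 hdiv).eventually_gt_atTop 0] with n hn hpos
  have hstep := hτ n.le_succ
  have hincrement := setIntegral_le_add_mul_integral_sub_log
    (Ioc_subset_Ioc_left bot_le : Ioc (τ n) (τ (n + 1)) ⊆ Ioc 0 (τ (n + 1)))
    measure_Ioc_lt_top.ne ((hint _).const_mul (cumul h (τ (n + 1)))⁻¹)
    (fun x => mul_nonneg (inv_nonneg.2 hpos.le) (h0 x)) hδ
  have hlength : lebesgue.real (Ioc (τ n) (τ (n + 1))) ≤ C := by
    rw [lebesgue_real_Ioc hstep, sub_le_iff_le_add']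
    exact_mod_cast hgap n
  rw [integral_const_mul, integral_const_mul, ← cumul_sub_cumul hint hstep,
    show ∫ x in Ioc 0 (τ (n + 1)), h x ∂lebesgue = cumul h (τ (n + 1)) from rfl,
    inv_mul_cancel₀ hpos.ne', ← div_eq_inv_mul] at hincrement
  rw [Pi.sub_apply, norm_sub_rev, Real.norm_of_nonneg (sub_nonneg.2 (cumul_mono h0 hint hstep)),
    Real.norm_of_nonneg hpos.le, ← div_le_iff₀ hpos]
  refine hincrement.trans (le_trans ?_ hn.le)
  gcongr

end IsRegularGammaProcess

end NegligibleIncrements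

section MonotoneInterpolation

lemma isEquivalent_of_eventually_le_of_le {ι : Type*} {l : Filter ι} {a b c : ι → ℝ}
    (hac : Asymptotics.IsEquivalent l c a) (hab : ∀ᶠ t in l, a t ≤ b t)
    (hbc : ∀ᶠ t in l, b t ≤ c t) : Asymptotics.IsEquivalent l b a := by
  refine Asymptotics.IsBigO.trans_isLittleO (.of_bound 1 ?_) hac.isLittleO
  filter_upwards [hab, hbc] with t hat hbt
  rw [one_mul, Pi.sub_apply, Pi.sub_apply, Real.norm_of_nonneg (sub_nonneg.2 hat),
    Real.norm_of_nonneg (sub_nonneg.2 (hat.trans hbt))]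
  gcongr

variable {ι : Type*} [LinearOrder ι] [NoMaxOrder ι] {τ : ℕ → ι} (hτ : Monotone τ)
  (hlim : Tendsto τ atTop atTop)
include hτ hlim

lemma exists_tendsto_eventually_mem_Ioc :
    ∃ ν : ι → ℕ, Tendsto ν atTop atTop ∧ ∀ᶠ t in atTop, t ∈ Ioc (τ (ν t)) (τ (ν t + 1)) := by
  have : Nonempty ι := ⟨τ 0⟩
  choose! ν hν using fun t => exists_mem_Ioc_of_tendsto_atTop (x := t) hτ hlim
  refine ⟨ν, tendsto_atTop.2 fun n => ?_, (eventually_gt_atTop _).mono hν⟩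
  filter_upwards [eventually_gt_atTop (τ n)] with t ht
  have hindex : τ n < τ (ν t + 1) := ht.trans_le (hν t ((hτ (Nat.zero_le n)).trans_lt ht)).2
  exact Nat.lt_succ_iff.1 (hτ.reflect_lt hindex)

variable {Ω : Type*} [MeasurableSpace Ω] {P : Measure Ω} [IsFiniteMeasure P] {m : ConvMode}
  {X : ι → Ω → ℝ} {a : ι → ℝ}

lemma ConvMode.tendstoOne_div_iff_of_monotone (hX : ∀ t, AEStronglyMeasurable (X t) P)
    (hXmono : ∀ᵐ ω ∂P, Monotone fun t => X t ω) (ha : Tendsto a atTop atTop) (hamono : Monotone a)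
    (hsucc : Asymptotics.IsEquivalent atTop (fun n => a (τ (n + 1))) fun n => a (τ n)) :
    m.TendstoOne P (fun t ω => X t ω / a t) atTop ↔
      m.TendstoOne P (fun n ω => X (τ n) ω / a (τ n)) atTop := by
  refine ⟨fun h => h.comp hlim, fun h => ?_⟩
  obtain ⟨ν, hν, hmem⟩ := exists_tendsto_eventually_mem_Ioc hτ hlim
  have hν' := (tendsto_add_atTop_nat 1).comp hν
  have hupper : Asymptotics.IsEquivalent atTop (fun t => a (τ (ν t + 1))) fun t => a (τ (ν t)) :=
    hsucc.comp_tendsto hν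
  have hmiddle : Asymptotics.IsEquivalent atTop a fun t => a (τ (ν t)) :=
    isEquivalent_of_eventually_le_of_le hupper (hmem.mono fun t ht => hamono ht.1.le)
      (hmem.mono fun t ht => hamono ht.2)
  have hbelow : m.TendstoOne P (fun t ω => X (τ (ν t)) ω / a t) atTop :=
    (tendstoOne_div_congr ((ha.comp hlim).comp hν) hmiddle.symm fun _ => hX _).1 (h.comp hν)
  have habove : m.TendstoOne P (fun t ω => X (τ (ν t + 1)) ω / a t) atTop :=
    (tendstoOne_div_congr ((ha.comp hlim).comp hν') (hupper.trans hmiddle.symm)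
      fun _ => hX _).1 (h.comp hν')
  have hconst (t : ι) : AEStronglyMeasurable (fun _ : Ω => a t) P := aestronglyMeasurable_const
  refine (tendstoOne_div_iff ha hX).2 ⟨?_, ?_⟩
  · exact (asympLE_of_le ha hmem (hXmono.mono fun ω hω t ht => hω ht.2)).trans
      ((tendstoOne_div_iff ha fun _ => hX _).1 habove).1 hX (fun _ => hX _) hconst
  · exact ((tendstoOne_div_iff ha fun _ => hX _).1 hbelow).2.trans
      (asympLE_of_le ha hmem (hXmono.mono fun ω hω t ht => hω ht.1.le)) hconst (fun _ => hX _) hX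

end MonotoneInterpolation

namespace IsRegularGammaProcess

variable {Ω : Type*} [MeasurableSpace Ω] {P : Measure Ω} {S : ℝ≥0 → Ω → ℝ}
  (hS : IsRegularGammaProcess S P) {h : ℝ≥0 → ℝ} (hh : StronglyMeasurable h)
  (hint : ∀ T, IntegrableOn h (Ioc 0 T) lebesgue)
include hS hh hint

lemma ae_monotone_gammaIntegral (h0 : ∀ x, 0 ≤ h x) :
    ∀ᵐ ω ∂P, Monotone fun t => gammaIntegral S h t ω := by
  filter_upwards [hS.ae_forall_integrableOn_pathMeasure hh hint] with ω hω s t hst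
  exact setIntegral_mono_set (hω t) (ae_of_all _ h0) (Ioc_subset_Ioc_right hst).eventuallyLE

variable [IsProbabilityMeasure P] {m : ConvMode} {p q : ℝ≥0}

lemma isEquivalent_cumul_node_succ (h0 : ∀ x, 0 ≤ h x)
    (hdiv : Tendsto (fun n => cumul h (node p q n)) atTop atTop)
    (hR : OrderlyDivergenceAlong m P S h p q) :
    Asymptotics.IsEquivalent atTop (fun n => cumul h (node p q (n + 1)))
      fun n => cumul h (node p q n) := by
  refine hS.isEquivalent_cumul_succ hh h0 hint (node_monotone p q)
    (fun n => (node_succ p q n).le) hdiv ?_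
  exact ConvMode.tendstoOne_iff_null.2 (ConvMode.null_inProbability_of_null
    (ConvMode.tendstoOne_iff_null.1 hR) fun n =>
      (hS.stronglyMeasurable_gammaRatio hh _).aestronglyMeasurable.sub aestronglyMeasurable_const)

theorem orderlyDivergence_iff_along (h0 : ∀ x, 0 ≤ h x) (hq : 0 < q)
    (hdiv : Tendsto (cumul h) atTop atTop) :
    OrderlyDivergence m P S h ↔ OrderlyDivergenceAlong m P S h p q := by
  have hnode := tendsto_node_atTop p hq
  refine ⟨fun hR => ConvMode.TendstoOne.comp hR hnode, fun hR => ?_⟩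
  exact (ConvMode.tendstoOne_div_iff_of_monotone (node_monotone p q) hnode
    (fun t => (hS.stronglyMeasurable_gammaIntegral hh t).aestronglyMeasurable)
    (hS.ae_monotone_gammaIntegral hh hint h0) hdiv (cumul_mono h0 hint)
    (hS.isEquivalent_cumul_node_succ hh hint h0 (hdiv.comp hnode) hR)).2 hR

end IsRegularGammaProcess

section RiemannSums

section Bounds

variable {α : Type*} [LinearOrder α] [TopologicalSpace α] [OrderClosedTopology α]
  [MeasurableSpace α]

/-- The Riemann–Stieltjes sum of `f` over the blocks `(τ j, τ (j + 1)]`, `j < n`, with respect to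
`μ`, each block being tagged with its left endpoint. -/
noncomputable def leftRiemannSum (μ : Measure α) (f : α → ℝ) (τ : ℕ → α) (n : ℕ) : ℝ :=
  ∑ j ∈ Finset.range n, μ.real (Ioc (τ j) (τ (j + 1))) * f (τ j)

/-- The Riemann–Stieltjes sum of `f` over the blocks `(τ j, τ (j + 1)]`, `j < n`, with respect to
`μ`, each block being tagged with its right endpoint. -/
noncomputable def rightRiemannSum (μ : Measure α) (f : α → ℝ) (τ : ℕ → α) (n : ℕ) : ℝ :=
  ∑ j ∈ Finset.range n, μ.real (Ioc (τ j) (τ (j + 1))) * f (τ (j + 1))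

variable [OpensMeasurableSpace α] [CompactIccSpace α] {μ : Measure α} [IsLocallyFiniteMeasure μ]
  {f : α → ℝ} {τ : ℕ → α} (hτ : Monotone τ) {n : ℕ} (hint : IntegrableOn f (Ioc (τ 0) (τ n)) μ)
include hτ hint

lemma setIntegral_le_sum_mul {u : ℕ → ℝ} (hu : ∀ j, ∀ x ∈ Ioc (τ j) (τ (j + 1)), f x ≤ u j) :
    ∫ x in Ioc (τ 0) (τ n), f x ∂μ ≤
      ∑ j ∈ Finset.range n, μ.real (Ioc (τ j) (τ (j + 1))) * u j := by
  rw [setIntegral_Ioc_eq_sum hτ n hint]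
  refine Finset.sum_le_sum fun j hj => ?_
  have hblock : Ioc (τ j) (τ (j + 1)) ⊆ Ioc (τ 0) (τ n) :=
    Ioc_subset_Ioc (hτ j.zero_le) (hτ (Finset.mem_range.1 hj))
  rw [← smul_eq_mul, ← setIntegral_const]
  exact setIntegral_mono_on (hint.mono_set hblock)
    (integrableOn_const measure_Ioc_lt_top.ne) measurableSet_Ioc (hu j)

lemma sum_mul_le_setIntegral {u : ℕ → ℝ} (hu : ∀ j, ∀ x ∈ Ioc (τ j) (τ (j + 1)), u j ≤ f x) :
    ∑ j ∈ Finset.range n, μ.real (Ioc (τ j) (τ (j + 1))) * u j ≤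
      ∫ x in Ioc (τ 0) (τ n), f x ∂μ := by
  have hneg := setIntegral_le_sum_mul hτ hint.neg fun j x hx => neg_le_neg (hu j x hx)
  simpa only [Pi.neg_apply, integral_neg, mul_neg, Finset.sum_neg_distrib, neg_le_neg_iff]
    using hneg

end Bounds

variable {f : ℝ≥0 → ℝ} {τ : ℕ → ℝ≥0}

lemma stronglyMeasurable_of_monotone_or_antitone (hf : Monotone f ∨ Antitone f) :
    StronglyMeasurable f :=
  (hf.elim Monotone.measurable Antitone.measurable).stronglyMeasurable

lemma integrableOn_Ioc_of_monotone_or_antitone {μ : Measure ℝ≥0} [IsLocallyFiniteMeasure μ]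
    (hf : Monotone f ∨ Antitone f) (a b : ℝ≥0) : IntegrableOn f (Ioc a b) μ :=
  ((hf.elim Monotone.locallyIntegrable Antitone.locallyIntegrable).integrableOn_isCompact
    isCompact_Icc).mono_set Ioc_subset_Icc_self

/-- The sums `U μ n` and `V μ n` enclose the integrals of `f` up to the time `τ n`, up to one time
step and up to the integral over the first block, simultaneously for all measures `μ`. -/
def IsRiemannSandwich (f : ℝ≥0 → ℝ) (τ : ℕ → ℝ≥0) (U V : Measure ℝ≥0 → ℕ → ℝ) : Prop :=
  ∀ (μ : Measure ℝ≥0) [IsLocallyFiniteMeasure μ] (n : ℕ),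
    U μ n ≤ ∫ x in Ioc 0 (τ (n + 1)), f x ∂μ ∧
    ∫ x in Ioc 0 (τ n), f x ∂μ ≤ V μ n + ∫ x in Ioc 0 (τ 1), f x ∂μ

variable (h0 : ∀ x, 0 ≤ f x) (hτ : Monotone τ)
include h0 hτ

lemma isRiemannSandwich_of_monotone (hf : Monotone f) :
    IsRiemannSandwich f τ (fun μ => leftRiemannSum μ f fun n => τ (n + 1))
      (fun μ => rightRiemannSum μ f τ) := by
  intro μ _ n
  have hint (a b : ℝ≥0) : IntegrableOn f (Ioc a b) μ :=
    integrableOn_Ioc_of_monotone_or_antitone (.inl hf) a b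
  have hmono {s t : Set ℝ≥0} (ht : IntegrableOn f t μ) (hst : s ⊆ t) :
      ∫ x in s, f x ∂μ ≤ ∫ x in t, f x ∂μ :=
    setIntegral_mono_set ht (ae_of_all _ h0) hst.eventuallyLE
  constructor
  · have hleft := sum_mul_le_setIntegral (hτ.comp Order.succ_mono) (hint (τ 1) (τ (n + 1)))
      fun j x hx => hf hx.1.le
    exact hleft.trans (hmono (hint _ _) (Ioc_subset_Ioc_left zero_le))
  · have hright := setIntegral_le_sum_mul hτ (hint (τ 0) (τ n)) fun j x hx => hf hx.2
    have hinit := hmono (hint 0 (τ 1)) (Ioc_subset_Ioc_right (hτ zero_le_one))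
    rw [← setIntegral_Ioc_add_setIntegral_Ioc zero_le (hτ n.zero_le) (hint 0 (τ n)), add_comm]
    exact add_le_add hright hinit

lemma isRiemannSandwich_of_antitone (hf : Antitone f) :
    IsRiemannSandwich f τ (fun μ => rightRiemannSum μ f τ)
      (fun μ => leftRiemannSum μ f fun n => τ (n + 1)) := by
  intro μ _ n
  have hint (a b : ℝ≥0) : IntegrableOn f (Ioc a b) μ :=
    integrableOn_Ioc_of_monotone_or_antitone (.inr hf) a b
  have hmono {s t : Set ℝ≥0} (ht : IntegrableOn f t μ) (hst : s ⊆ t) :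
      ∫ x in s, f x ∂μ ≤ ∫ x in t, f x ∂μ :=
    setIntegral_mono_set ht (ae_of_all _ h0) hst.eventuallyLE
  constructor
  · have hright := sum_mul_le_setIntegral hτ (hint (τ 0) (τ n)) fun j x hx => hf hx.2
    exact hright.trans (hmono (hint _ _) (Ioc_subset_Ioc bot_le (hτ n.le_succ)))
  · have hleft := setIntegral_le_sum_mul (hτ.comp Order.succ_mono) (hint (τ 1) (τ (n + 1)))
      fun j x hx => hf hx.1.le
    have hstep := hmono (hint 0 (τ (n + 1))) (Ioc_subset_Ioc_right (hτ n.le_succ))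
    rw [← setIntegral_Ioc_add_setIntegral_Ioc zero_le (hτ (Nat.le_add_left 1 n)) (hint 0 _),
      add_comm] at hstep
    exact hstep.trans (add_le_add_left hleft _)

end RiemannSums

section Interlacing

variable {a b : ℕ → ℝ}

lemma isEquivalent_comp_succ_iff : Asymptotics.IsEquivalent atTop (fun n => a (n + 1))
    (fun n => b (n + 1)) ↔ Asymptotics.IsEquivalent atTop a b := by
  conv_rhs => rw [Asymptotics.IsEquivalent, ← map_add_atTop_eq_nat 1, Asymptotics.isLittleO_map]
  rfl

lemma isEquivalent_of_le_succ_of_le_add (ha : Tendsto a atTop atTop)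
    (hsucc : Asymptotics.IsEquivalent atTop (fun n => a (n + 1)) a) (hba : ∀ n, b n ≤ a (n + 1))
    {C : ℝ} (hab : ∀ n, a n ≤ b n + C) : Asymptotics.IsEquivalent atTop b a := by
  have hshift : Asymptotics.IsEquivalent atTop (fun n => a n - C) a :=
    Asymptotics.IsEquivalent.refl.sub_isLittleO
      (Asymptotics.isLittleO_const_left.2 (.inr (tendsto_norm_atTop_atTop.comp ha)))
  exact (isEquivalent_of_eventually_le_of_le (hsucc.trans hshift.symm)
    (.of_forall fun n => sub_le_iff_le_add.2 (hab n)) (.of_forall hba)).trans hshift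

lemma isEquivalent_of_le_succ_of_le_add' (hb : Tendsto b atTop atTop)
    (hsucc : Asymptotics.IsEquivalent atTop (fun n => b (n + 1)) b) (hba : ∀ n, b n ≤ a (n + 1))
    {C : ℝ} (hab : ∀ n, a n ≤ b n + C) : Asymptotics.IsEquivalent atTop b a := by
  have hshift : Asymptotics.IsEquivalent atTop (fun n => b n + C) b :=
    Asymptotics.IsEquivalent.refl.add_isLittleO
      (Asymptotics.isLittleO_const_left.2 (.inr (tendsto_norm_atTop_atTop.comp hb)))
  have hmiddle : Asymptotics.IsEquivalent atTop (fun n => a (n + 1)) b :=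
    isEquivalent_of_eventually_le_of_le ((isEquivalent_comp_succ_iff.2 hshift).trans hsucc)
      (.of_forall hba) (.of_forall fun n => hab (n + 1))
  exact (isEquivalent_comp_succ_iff.1 (hmiddle.trans hsucc.symm)).symm

end Interlacing

section RiemannSumsOfDiscretization

variable {f : ℝ≥0 → ℝ} {p q : ℝ≥0}

lemma discretization_nonneg (h0 : ∀ x, 0 ≤ f x) (x : ℝ≥0) : 0 ≤ discretization p q f x :=
  stepFunction_mem (node_monotone p q) (mem_Ici.2 le_rfl) (fun _ => mem_Ici.2 (h0 _)) x

lemma discretization_of_le {x : ℝ≥0} (hx : x ≤ p) : discretization p q f x = 0 := by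
  refine stepFunction_of_forall_notMem_Ioc fun j hj => (hj.1.trans_le hx).not_ge ?_
  exact (node_zero p q).ge.trans (node_monotone p q j.zero_le)

variable (μ : Measure ℝ≥0)

lemma setIntegral_discretization [IsLocallyFiniteMeasure μ] (n : ℕ) :
    ∫ x in Ioc 0 (node p q n), discretization p q f x ∂μ = rightRiemannSum μ f (node p q) n := by
  rw [setIntegral_eq_of_subset_of_forall_sdiff_eq_zero measurableSet_Ioc
    (Ioc_subset_Ioc_left zero_le : Ioc (node p q 0) (node p q n) ⊆ _) fun x hx => ?_]
  · exact setIntegral_stepFunction (node_monotone p q) n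
  · exact discretization_of_le ((not_lt.1 fun h => hx.2 ⟨h, hx.1.2⟩).trans_eq (node_zero p q))

lemma integrableOn_discretization [IsLocallyFiniteMeasure μ] (hq : 0 < q) (T : ℝ≥0) :
    IntegrableOn (discretization p q f) (Ioc 0 T) μ := by
  obtain ⟨n, hn⟩ := ((tendsto_node_atTop p hq).eventually_ge_atTop T).exists
  refine IntegrableOn.of_forall_sdiff_eq_zero (integrableOn_stepFunction (node_monotone p q) n)
    measurableSet_Ioc fun x hx => discretization_of_le ?_
  exact (not_lt.1 fun h => hx.2 ⟨h, hx.1.2.trans hn⟩).trans_eq (node_zero p q)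

lemma cumul_discretization (f : ℝ≥0 → ℝ) (p q : ℝ≥0) (n : ℕ) :
    cumul (discretization p q f) (node p q n) = rightRiemannSum lebesgue f (node p q) n :=
  setIntegral_discretization lebesgue n

lemma cumul_discretization_eq_leftRiemannSum (f : ℝ≥0 → ℝ) (p q : ℝ≥0) (n : ℕ) :
    cumul (discretization p q f) (node p q n) =
      leftRiemannSum lebesgue f (fun n => node p q (n + 1)) n := by
  simp only [cumul_discretization, leftRiemannSum, rightRiemannSum,
    lebesgue_real_Ioc (node_monotone p q (Nat.le_succ _)), coe_node_succ_sub_coe_node]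

end RiemannSumsOfDiscretization

namespace IsRegularGammaProcess

variable {Ω : Type*} [MeasurableSpace Ω] {P : Measure Ω} {S : ℝ≥0 → Ω → ℝ}
  (hS : IsRegularGammaProcess S P) {f : ℝ≥0 → ℝ} {p q : ℝ≥0}
include hS

lemma discreteRatio_eq_gammaRatio_discretization (n : ℕ) (ω : Ω) :
    discreteRatio S f p q n ω = gammaRatio S (discretization p q f) (node p q n) ω := by
  have hstep (j : ℕ) : node p q j ≤ node p q (j + 1) := node_monotone p q j.le_succ
  have hshift (u : ℕ → ℝ) : ∑ k ∈ Finset.Icc 1 n, u k = ∑ j ∈ Finset.range n, u (j + 1) := by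
    rw [Finset.range_eq_Ico, Finset.sum_Ico_add', zero_add]
    rfl
  simp only [discreteRatio, gammaRatio, gammaIntegral, cumul, setIntegral_discretization,
    rightRiemannSum, hS.pathMeasure_real_Ioc ω (hstep _), lebesgue_real_Ioc (hstep _),
    coe_node_succ_sub_coe_node, hshift, Nat.add_sub_cancel, mul_comm]

lemma discreteOrderlyDivergence_iff_discretization {m : ConvMode} :
    DiscreteOrderlyDivergence m P S f p q ↔
      OrderlyDivergenceAlong m P S (discretization p q f) p q :=
  ConvMode.tendstoOne_congr (ae_of_all _ fun ω n =>
    hS.discreteRatio_eq_gammaRatio_discretization n ω)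

lemma memLp_increment {s t : ℝ≥0} (hst : s < t) (r : ℝ≥0) :
    MemLp (fun ω => S t ω - S s ω) r P := by
  have hlaw := hS.law_increment s t hst
  have hmem := memLp_id_gammaMeasure (sub_pos.2 (NNReal.coe_lt_coe.2 hst)) one_pos r
  rw [← hlaw.map_eq] at hmem
  exact hmem.comp_of_map hlaw.aemeasurable

lemma memLp_gammaIntegral {t : ℝ≥0} (ht : 0 < t) (hf : StronglyMeasurable f) {C : ℝ}
    (hC : ∀ x ∈ Ioc 0 t, ‖f x‖ ≤ C) (r : ℝ≥0) : MemLp (gammaIntegral S f t) r P := by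
  refine ((hS.memLp_increment ht r).const_mul C).mono
    (hS.stronglyMeasurable_gammaIntegral hf t).aestronglyMeasurable (ae_of_all _ fun ω => ?_)
  have hbound := norm_setIntegral_le_of_norm_le_const (μ := pathMeasure fun u => S u ω)
    measure_Ioc_lt_top hC
  rw [hS.pathMeasure_real_Ioc ω zero_le] at hbound
  exact hbound.trans (le_abs_self _)

lemma identDistrib_riemannSum [IsProbabilityMeasure P] (f : ℝ≥0 → ℝ) (p q : ℝ≥0) :
    IdentDistrib (fun ω n => rightRiemannSum (pathMeasure fun u => S u ω) f (node p q) n)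
      (fun ω n => leftRiemannSum (pathMeasure fun u => S u ω) f (fun n => node p q (n + 1)) n)
      P P := by
  have hone (T : ℝ≥0) : IntegrableOn (fun _ => (1 : ℝ)) (Ioc 0 T) lebesgue :=
    integrableOn_const measure_Ioc_lt_top.ne
  have hτ := node_monotone p q
  have hblocks := hS.identDistrib_blockIntegral stronglyMeasurable_const stronglyMeasurable_const
    hone hone hτ (hτ.comp Order.succ_mono) fun j => ⟨aemeasurable_const, aemeasurable_const, by
      simp [Measure.map_const, lebesgue_Ioc, coe_node_succ_sub_coe_node]⟩
  have hsums := hblocks.comp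
    (u := fun y n => ∑ j ∈ Finset.range n, y j * f (node p q (j + 1))) (by fun_prop)
  simpa [blockIntegral, Function.comp_def, rightRiemannSum, leftRiemannSum] using hsums

variable (h0 : ∀ x, 0 ≤ f x) (hf : Monotone f ∨ Antitone f)
include h0 hf

lemma memLp_gammaIntegral_of_monotone_or_antitone {t : ℝ≥0} (ht : 0 < t) (r : ℝ≥0) :
    MemLp (gammaIntegral S f t) r P := by
  refine hS.memLp_gammaIntegral ht (stronglyMeasurable_of_monotone_or_antitone hf)
    (C := f 0 + f t) (fun x hx => ?_) r
  rw [Real.norm_of_nonneg (h0 x)]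
  rcases hf with hf | hf
  · linarith [hf hx.2, h0 0]
  · linarith [hf hx.1.le, h0 t]

variable [IsProbabilityMeasure P] {m : ConvMode} (hq : 0 < q)
  (hdiv : Tendsto (cumul f) atTop atTop)
include hq hdiv

section Sandwich

variable {U V : Measure ℝ≥0 → ℕ → ℝ} (hUV : IsRiemannSandwich f (node p q) U V)
  (hU : ∀ n, cumul (discretization p q f) (node p q n) = U lebesgue n)
  (hV : ∀ n, cumul (discretization p q f) (node p q n) = V lebesgue n)
include hUV hU hV

lemma isEquivalent_cumul_of_orderlyDivergenceAlong_or_discrete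
    (hR : OrderlyDivergenceAlong m P S f p q ∨ DiscreteOrderlyDivergence m P S f p q) :
    Asymptotics.IsEquivalent atTop (fun n => cumul (discretization p q f) (node p q n))
        (fun n => cumul f (node p q n)) ∧
      Asymptotics.IsEquivalent atTop (fun n => cumul f (node p q (n + 1)))
        fun n => cumul f (node p q n) := by
  have hlower (n : ℕ) : cumul (discretization p q f) (node p q n) ≤ cumul f (node p q (n + 1)) :=
    (hU n).trans_le (hUV lebesgue n).1
  have hupper (n : ℕ) : cumul f (node p q n) ≤
      cumul (discretization p q f) (node p q n) + cumul f (node p q 1) :=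
    hV n ▸ (hUV lebesgue n).2
  have hdivf : Tendsto (fun n => cumul f (node p q n)) atTop atTop :=
    hdiv.comp (tendsto_node_atTop p hq)
  rcases hR with hR | hR
  · have hsucc := hS.isEquivalent_cumul_node_succ (stronglyMeasurable_of_monotone_or_antitone hf)
      (fun T => integrableOn_Ioc_of_monotone_or_antitone hf 0 T) h0 hdivf hR
    exact ⟨isEquivalent_of_le_succ_of_le_add hdivf hsucc hlower hupper, hsucc⟩
  · have hdivd : Tendsto (fun n => cumul (discretization p q f) (node p q n)) atTop atTop :=
      tendsto_atTop_mono (fun n => by linarith [hupper n])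
        (tendsto_atTop_add_const_right atTop (-cumul f (node p q 1)) hdivf)
    have hsucc := hS.isEquivalent_cumul_node_succ (stronglyMeasurable_discretization p q f)
      (integrableOn_discretization lebesgue hq) (discretization_nonneg h0) hdivd
      (hS.discreteOrderlyDivergence_iff_discretization.1 hR)
    have hequiv := isEquivalent_of_le_succ_of_le_add' hdivd hsucc hlower hupper
    exact ⟨hequiv, ((isEquivalent_comp_succ_iff.2 hequiv.symm).trans hsucc).trans hequiv⟩

lemma orderlyDivergenceAlong_iff_discrete_of_isRiemannSandwich
    (hlaw : IdentDistrib (fun ω n => U (pathMeasure fun u => S u ω) n)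
      (fun ω n => V (pathMeasure fun u => S u ω) n) P P)
    (hlaw_discrete : IdentDistrib (fun ω n => U (pathMeasure fun u => S u ω) n)
      (fun ω n => gammaIntegral S (discretization p q f) (node p q n) ω) P P) :
    OrderlyDivergenceAlong m P S f p q ↔ DiscreteOrderlyDivergence m P S f p q := by
  suffices hiff : OrderlyDivergenceAlong m P S f p q ∨ DiscreteOrderlyDivergence m P S f p q →
      (OrderlyDivergenceAlong m P S f p q ↔ DiscreteOrderlyDivergence m P S f p q) from
    ⟨fun h => (hiff (.inl h)).1 h, fun h => (hiff (.inr h)).2 h⟩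
  intro hR
  obtain ⟨hequiv, hsucc⟩ :=
    hS.isEquivalent_cumul_of_orderlyDivergenceAlong_or_discrete h0 hf hq hdiv hUV hU hV hR
  have hdivf : Tendsto (fun n => cumul f (node p q n)) atTop atTop :=
    hdiv.comp (tendsto_node_atTop p hq)
  have hmeas {h : ℝ≥0 → ℝ} (hh : StronglyMeasurable h) (n : ℕ) :
      AEStronglyMeasurable (gammaIntegral S h (node p q n)) P :=
    (hS.stronglyMeasurable_gammaIntegral hh _).aestronglyMeasurable
  calc OrderlyDivergenceAlong m P S f p q
      ↔ m.TendstoOne P (fun n ω => U (pathMeasure fun u => S u ω) n / cumul f (node p q n))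
          atTop :=
        ConvMode.tendstoOne_div_iff_of_sandwich hdivf hsucc
          (hmeas (stronglyMeasurable_of_monotone_or_antitone hf))
          (hS.memLp_gammaIntegral_of_monotone_or_antitone h0 hf (hq.trans_le (by simp [node])))
          hlaw (ae_of_all _ fun ω n => (hUV _ n).1) (ae_of_all _ fun ω n => (hUV _ n).2)
    _ ↔ m.TendstoOne P (fun n ω => gammaIntegral S (discretization p q f) (node p q n) ω /
          cumul f (node p q n)) atTop :=
        ConvMode.tendstoOne_div_congr_of_identDistrib hlaw_discrete _
    _ ↔ OrderlyDivergenceAlong m P S (discretization p q f) p q :=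
        ConvMode.tendstoOne_div_congr hdivf hequiv.symm
          (hmeas (stronglyMeasurable_discretization p q f))
    _ ↔ DiscreteOrderlyDivergence m P S f p q :=
        hS.discreteOrderlyDivergence_iff_discretization.symm

end Sandwich

theorem orderlyDivergenceAlong_iff_discrete :
    OrderlyDivergenceAlong m P S f p q ↔ DiscreteOrderlyDivergence m P S f p q := by
  have hτ := node_monotone p q
  have hleft := cumul_discretization_eq_leftRiemannSum f p q
  have hright := cumul_discretization f p q
  have hlaw := hS.identDistrib_riemannSum f p q
  have hintegral : (fun ω n => gammaIntegral S (discretization p q f) (node p q n) ω) =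
      fun ω n => rightRiemannSum (pathMeasure fun u => S u ω) f (node p q) n :=
    funext₂ fun _ n => setIntegral_discretization _ n
  rcases hf with hmono | hanti
  · exact hS.orderlyDivergenceAlong_iff_discrete_of_isRiemannSandwich h0 (.inl hmono) hq hdiv
      (isRiemannSandwich_of_monotone h0 hτ hmono) hleft hright hlaw.symm (hintegral ▸ hlaw.symm)
  · exact hS.orderlyDivergenceAlong_iff_discrete_of_isRiemannSandwich h0 (.inr hanti) hq hdiv
      (isRiemannSandwich_of_antitone h0 hτ hanti) hright hleft hlaw
      (by rw [hintegral]; exact .refl hlaw.aemeasurable_fst)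

end IsRegularGammaProcess

section Rearrangement

/-- The nodes preceded by the origin, so that consecutive terms bound the intervals between which
a rearrangement takes place, the initial interval `(0, p]` included. -/
def extendedNode (p q : ℝ≥0) : ℕ → ℝ≥0
  | 0 => 0
  | n + 1 => node p q n

lemma extendedNode_monotone (p q : ℝ≥0) : Monotone (extendedNode p q) :=
  monotone_nat_of_le_succ fun n => by
    cases n with
    | zero => exact zero_le
    | succ n => exact node_monotone p q n.le_succ

lemma tendsto_extendedNode_atTop (p : ℝ≥0) {q : ℝ≥0} (hq : 0 < q) :
    Tendsto (extendedNode p q) atTop atTop :=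
  (tendsto_add_atTop_iff_nat 1).1 (tendsto_node_atTop p hq)

lemma iUnion_Ioc_extendedNode (p : ℝ≥0) {q : ℝ≥0} (hq : 0 < q) :
    ⋃ j, Ioc (extendedNode p q j) (extendedNode p q (j + 1)) = Ioi 0 :=
  iUnion_Ioc_map_succ_eq_Ioi (fun _ => zero_le)
    (not_bddAbove_of_tendsto_atTop (tendsto_extendedNode_atTop p hq))

lemma ae_restrict_Ioc_of_ae_restrict_Ioi {α : Type*} [Preorder α] [MeasurableSpace α]
    {μ : Measure α} {r : α → Prop} {a b c : α} (hab : a ≤ b) (h : ∀ᵐ x ∂μ.restrict (Ioi a), r x) :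
    ∀ᵐ x ∂μ.restrict (Ioc b c), r x :=
  ae_restrict_of_ae_restrict_of_subset (fun _ hx => hab.trans_lt hx.1) h

namespace IsRearrangementBetweenNodes

variable {f g g' : ℝ≥0 → ℝ} {p q : ℝ≥0} (hg : IsRearrangementBetweenNodes g f p q)
include hg

lemma identDistrib (j : ℕ) :
    IdentDistrib g f (lebesgue.restrict (Ioc (extendedNode p q j) (extendedNode p q (j + 1))))
      (lebesgue.restrict (Ioc (extendedNode p q j) (extendedNode p q (j + 1)))) := by
  cases j with
  | zero => exact hg.1
  | succ n => exact hg.2 n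

lemma congr (heq : ∀ᵐ x ∂lebesgue.restrict (Ioi 0), g x = g' x) :
    IsRearrangementBetweenNodes g' f p q := by
  have hcongr {a b : ℝ≥0} (hab : IdentDistrib g f (lebesgue.restrict (Ioc a b))
      (lebesgue.restrict (Ioc a b))) :
      IdentDistrib g' f (lebesgue.restrict (Ioc a b)) (lebesgue.restrict (Ioc a b)) :=
    (IdentDistrib.of_ae_eq hab.aemeasurable_fst
      (ae_restrict_Ioc_of_ae_restrict_Ioi zero_le heq)).symm.trans hab
  exact ⟨hcongr hg.1, fun k => hcongr (hg.2 k)⟩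

lemma exists_stronglyMeasurable_nonneg (hq : 0 < q) (h0 : ∀ x, 0 ≤ f x) :
    ∃ g' : ℝ≥0 → ℝ, StronglyMeasurable g' ∧ (∀ x, 0 ≤ g' x) ∧
      ∀ᵐ x ∂lebesgue.restrict (Ioi 0), g x = g' x := by
  have hmeas : AEMeasurable g (lebesgue.restrict (Ioi 0)) := by
    rw [← iUnion_Ioc_extendedNode p hq, aemeasurable_iUnion_iff]
    exact fun j => (hg.identDistrib j).aemeasurable_fst
  have hnonneg : ∀ᵐ x ∂lebesgue.restrict (Ioi 0), 0 ≤ g x := by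
    rw [← iUnion_Ioc_extendedNode p hq, ae_restrict_iUnion_iff]
    exact fun j => (hg.identDistrib j).symm.ae_snd (p := fun y => 0 ≤ y) measurableSet_Ici
      (ae_of_all _ h0)
  refine ⟨fun x => max (hmeas.mk g x) 0,
    (hmeas.measurable_mk.max measurable_const).stronglyMeasurable, fun x => le_max_right _ _, ?_⟩
  filter_upwards [hnonneg, hmeas.ae_eq_mk] with x hx hmk
  rw [← hmk, max_eq_left hx]

variable (hint : ∀ T, IntegrableOn f (Ioc 0 T) lebesgue)
include hint

lemma integrableOn (hq : 0 < q) (T : ℝ≥0) : IntegrableOn g (Ioc 0 T) lebesgue := by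
  obtain ⟨n, hn⟩ := ((tendsto_extendedNode_atTop p hq).eventually_ge_atTop T).exists
  refine IntegrableOn.mono_set ?_ (Ioc_subset_Ioc_right hn)
  exact integrableOn_Ioc_of_forall_integrableOn (extendedNode_monotone p q) fun j _ =>
    (hg.identDistrib j).integrable_iff.2 ((hint _).mono_set (Ioc_subset_Ioc_left zero_le))

lemma cumul_node_eq (hq : 0 < q) (n : ℕ) : cumul g (node p q n) = cumul f (node p q n) := by
  have hτ := extendedNode_monotone p q
  calc cumul g (node p q n)
      = ∑ j ∈ Finset.range (n + 1),
          ∫ x in Ioc (extendedNode p q j) (extendedNode p q (j + 1)), g x ∂lebesgue :=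
        setIntegral_Ioc_eq_sum hτ (n + 1) (hg.integrableOn hint hq _)
    _ = ∑ j ∈ Finset.range (n + 1),
          ∫ x in Ioc (extendedNode p q j) (extendedNode p q (j + 1)), f x ∂lebesgue :=
        Finset.sum_congr rfl fun j _ => (hg.identDistrib j).integral_eq
    _ = cumul f (node p q n) := (setIntegral_Ioc_eq_sum hτ (n + 1) (hint _)).symm

end IsRearrangementBetweenNodes

namespace IsRegularGammaProcess

variable {Ω : Type*} [MeasurableSpace Ω] {P : Measure Ω} {S : ℝ≥0 → Ω → ℝ}
  (hS : IsRegularGammaProcess S P) {m : ConvMode} {f g : ℝ≥0 → ℝ} {p q : ℝ≥0}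
include hS

lemma ae_gammaRatio_eq (heq : ∀ᵐ x ∂lebesgue.restrict (Ioi 0), f x = g x) :
    ∀ᵐ ω ∂P, ∀ t, gammaRatio S f t ω = gammaRatio S g t ω := by
  have hcumul (t : ℝ≥0) : cumul f t = cumul g t :=
    integral_congr_ae (ae_restrict_Ioc_of_ae_restrict_Ioi le_rfl heq)
  filter_upwards [ae_all_iff.2 fun n : ℕ => hS.ae_ae_restrict_pathMeasure
    (ae_restrict_Ioc_of_ae_restrict_Ioi (c := (n : ℝ≥0)) le_rfl heq)] with ω hω t
  obtain ⟨n, hn⟩ := exists_nat_ge t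
  rw [gammaRatio, gammaRatio, hcumul, gammaIntegral, gammaIntegral, integral_congr_ae
    (ae_restrict_of_ae_restrict_of_subset (Ioc_subset_Ioc_right hn) (hω n))]

variable [IsProbabilityMeasure P] (hg : IsRearrangementBetweenNodes g f p q)
  (hf : StronglyMeasurable f) (hint : ∀ T, IntegrableOn f (Ioc 0 T) lebesgue) (hq : 0 < q)
include hg hf hint hq

lemma orderlyDivergenceAlong_iff_of_rearrangement (hgm : StronglyMeasurable g) :
    OrderlyDivergenceAlong m P S g p q ↔ OrderlyDivergenceAlong m P S f p q := by
  have hτ := extendedNode_monotone p q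
  have hlaw : IdentDistrib (fun ω n => gammaIntegral S g (node p q n) ω)
      (fun ω n => gammaIntegral S f (node p q n) ω) P P :=
    (hS.identDistrib_integral_pathMeasure hgm hf (hg.integrableOn hint hq) hint hτ hτ
      hg.identDistrib).comp (u := fun (y : ℕ → ℝ) n => y (n + 1)) (by fun_prop)
  calc OrderlyDivergenceAlong m P S g p q
      ↔ m.TendstoOne P (fun n ω => gammaIntegral S g (node p q n) ω / cumul f (node p q n))
          atTop := by simp only [← hg.cumul_node_eq hint hq]; rfl
    _ ↔ OrderlyDivergenceAlong m P S f p q :=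
        ConvMode.tendstoOne_div_congr_of_identDistrib hlaw _

theorem orderlyDivergence_iff_of_rearrangement (h0 : ∀ x, 0 ≤ f x)
    (hdiv : Tendsto (cumul f) atTop atTop) :
    OrderlyDivergence m P S g ↔ OrderlyDivergence m P S f := by
  obtain ⟨g', hgm', h0', heq⟩ := hg.exists_stronglyMeasurable_nonneg hq h0
  have hg' := hg.congr heq
  have hint' := hg'.integrableOn hint hq
  have hdiv' : Tendsto (cumul g') atTop atTop := by
    refine tendsto_atTop_of_monotone_of_subseq (cumul_mono h0' hint') (φ := node p q)
      (l := atTop) ?_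
    exact (hdiv.comp (tendsto_node_atTop p hq)).congr fun n => (hg'.cumul_node_eq hint hq n).symm
  calc OrderlyDivergence m P S g
      ↔ OrderlyDivergence m P S g' := ConvMode.tendstoOne_congr (hS.ae_gammaRatio_eq heq)
    _ ↔ OrderlyDivergenceAlong m P S g' p q :=
        hS.orderlyDivergence_iff_along hgm' hint' h0' hq hdiv'
    _ ↔ OrderlyDivergenceAlong m P S f p q :=
        hS.orderlyDivergenceAlong_iff_of_rearrangement hg' hf hint hq hgm'
    _ ↔ OrderlyDivergence m P S f := (hS.orderlyDivergence_iff_along hf hint h0 hq hdiv).symm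

end IsRegularGammaProcess

end Rearrangement

section Versions

variable {Ω : Type*} [MeasurableSpace Ω] {P : Measure Ω} {S S' : ℝ≥0 → Ω → ℝ}
  (hSS' : ∀ᵐ ω ∂P, ∀ t, S' t ω = S t ω) {m : ConvMode} {f : ℝ≥0 → ℝ} {p q : ℝ≥0}
include hSS'

lemma orderlyDivergence_congr : OrderlyDivergence m P S' f ↔ OrderlyDivergence m P S f :=
  ConvMode.tendstoOne_congr <| hSS'.mono fun ω hω t => by
    simp only [gammaRatio, gammaIntegral, hω]

lemma orderlyDivergenceAlong_congr :
    OrderlyDivergenceAlong m P S' f p q ↔ OrderlyDivergenceAlong m P S f p q :=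
  ConvMode.tendstoOne_congr <| hSS'.mono fun ω hω n => by
    simp only [gammaRatio, gammaIntegral, hω]

lemma discreteOrderlyDivergence_congr :
    DiscreteOrderlyDivergence m P S' f p q ↔ DiscreteOrderlyDivergence m P S f p q :=
  ConvMode.tendstoOne_congr <| hSS'.mono fun ω hω n => by simp only [discreteRatio, hω]

end Versions

theorem mainTheorem8 {Ω : Type*} [MeasurableSpace Ω] (P : Measure Ω) [IsProbabilityMeasure P]
    (S : ℝ≥0 → Ω → ℝ) (hS : IsGammaProcess S P)
    (f : ℝ≥0 → ℝ) (hf_nonneg : ∀ x, 0 ≤ f x) (hf_mono : Monotone f ∨ Antitone f)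
    (hf_div : Tendsto (cumul f) atTop atTop) (m : ConvMode) :
    (∀ p q : ℝ≥0, 0 < q →
      (OrderlyDivergence m P S f ↔ OrderlyDivergenceAlong m P S f p q) ∧
      (OrderlyDivergence m P S f ↔ DiscreteOrderlyDivergence m P S f p q)) ∧
    (∀ p q : ℝ≥0, 0 < q → ∀ g : ℝ≥0 → ℝ, IsRearrangementBetweenNodes g f p q →
      (OrderlyDivergence m P S f ↔ OrderlyDivergence m P S g)) := by
  obtain ⟨S', hS', hversion⟩ := hS.exists_isRegularGammaProcess
  have hmeas := stronglyMeasurable_of_monotone_or_antitone hf_mono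
  have hint := integrableOn_Ioc_of_monotone_or_antitone (μ := lebesgue) hf_mono 0
  simp only [← orderlyDivergence_congr hversion, ← orderlyDivergenceAlong_congr hversion,
    ← discreteOrderlyDivergence_congr hversion]
  refine ⟨fun p q hq => ?_, fun p q hq g hg =>
    (hS'.orderlyDivergence_iff_of_rearrangement hg hmeas hint hq hf_nonneg hf_div).symm⟩
  have halong := hS'.orderlyDivergence_iff_along (m := m) (p := p) hmeas hint hf_nonneg hq hf_div
  exact ⟨halong, halong.trans (hS'.orderlyDivergenceAlong_iff_discrete hf_nonneg hf_mono hq hf_div)⟩
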